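/- For a lattice $\Lambda\subset\mathbb C$ put $g_2(\Lambda)=60\sum_{0\ne w\in\Lambda}w^{-4}$, $g_3(\Lambda)=140\sum_{0\ne w\in\Lambda}w^{-6}$ and $j(\Lambda)=2^6 3^3\,g_2(\Lambda)^3/\bigl(g_2(\Lambda)^3-27g_3(\Lambda)^2\bigr)$; then $j(\Lambda)$ depends on $\Lambda$ only up to scaling, and $j(\Lambda)=j(\omega_1/\omega_2)$ is the value of the modular function $j$ whenever $\omega_1,\omega_2$ is a basis of $\Lambda$ with $\operatorname{Im}(\omega_1/\omega_2)>0$. Let $\Sigma$ be an imaginary quadratic number field with an embedding into $\mathbb C$, and let $R$ be an order in $\Sigma$, i.e. a subring that is finitely generated as an additive group and spans $\Sigma$ over $\mathbb Q$. The ideal class group of $R$ is the group of invertible fractional ideals of $R$ modulo the principal ones. For an ideal class $\mathfrak k$ of $R$ let $j(\mathfrak k)$, the class invariant, be $j(\mathfrak a)$ for any ideal $\mathfrak a\in\mathfrak k$, viewed as a lattice in $\mathbb C$. Then: 1. $R$ has only finitely many ideal classes $\mathfrak k^{(1)},\dots,\mathfrak k^{(h)}$; 2. every class invariant $j(\mathfrak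 k^{(\nu)})$ is an algebraic integer; 3. the class polynomial $H_R(X)=\prod_{\nu=1}^{h}\bigl(X-j(\mathfrak k^{(\nu)})\bigr)$ has rational integer coefficients. -/

import Mathlib

open scoped nonZeroDivisors Polynomial

noncomputable section

/-! ### Lattice functions and the modular invariant `j` -/

/-- The lattice sum `∑ w⁻ⁿ` over the nonzero elements `w` of a lattice `Λ` in `ℂ`, for `n ≠ 0`
(the summand of `w = 0` is `(0 ^ n)⁻¹ = 0`). -/
def latticeG (Λ : Submodule ℤ ℂ) (n : ℕ) : ℂ := ∑' w : Λ, ((w : ℂ) ^ n)⁻¹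

/-- `g₂(Λ) = 60 ∑ w⁻⁴`. -/
def latticeG2 (Λ : Submodule ℤ ℂ) : ℂ := 60 * latticeG Λ 4

/-- `g₃(Λ) = 140 ∑ w⁻⁶`. -/
def latticeG3 (Λ : Submodule ℤ ℂ) : ℂ := 140 * latticeG Λ 6

/-- The discriminant `Δ(Λ) = g₂(Λ)³ - 27 g₃(Λ)²`. -/
def latticeDisc (Λ : Submodule ℤ ℂ) : ℂ := latticeG2 Λ ^ 3 - 27 * latticeG3 Λ ^ 2

/-- The invariant `j(Λ) = 2⁶ 3³ g₂(Λ)³ / Δ(Λ)` of a lattice `Λ` in `ℂ`. -/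
def latticeJ (Λ : Submodule ℤ ℂ) : ℂ := 2 ^ 6 * 3 ^ 3 * latticeG2 Λ ^ 3 / latticeDisc Λ

/-- The modular function `j(ω)`, the invariant of the lattice `ℤ ω + ℤ`. -/
def modularJ (ω : UpperHalfPlane) : ℂ := latticeJ (Submodule.span ℤ {(ω : ℂ), 1})

lemma latticeG_smul (Λ Λ' : Submodule ℤ ℂ) (z : ℂ) (hz : z ≠ 0)
    (h : ∀ w, w ∈ Λ' ↔ ∃ v ∈ Λ, w = z * v) (n : ℕ) :
    latticeG Λ' n = (z ^ n)⁻¹ * latticeG Λ n := by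
  let e : Λ ≃ Λ' :=
    { toFun := fun v => ⟨z * v, (h _).2 ⟨v, v.2, rfl⟩⟩
      invFun := fun w => ⟨z⁻¹ * w, by
        obtain ⟨v, hv, e⟩ := (h _).1 w.2
        rw [e, inv_mul_cancel_left₀ hz]; exact hv⟩
      left_inv := fun v => by ext; simp [hz]
      right_inv := fun w => by ext; simp [hz] }
  unfold latticeG
  rw [← e.tsum_eq, ← tsum_mul_left]
  refine tsum_congr fun v => ?_
  change ((z * (v : ℂ)) ^ n)⁻¹ = _
  rw [mul_pow, mul_inv]

/-- Homothetic lattices have the same invariant. -/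
lemma latticeJ_smul (Λ Λ' : Submodule ℤ ℂ) (z : ℂ) (hz : z ≠ 0)
    (h : ∀ w, w ∈ Λ' ↔ ∃ v ∈ Λ, w = z * v) : latticeJ Λ' = latticeJ Λ := by
  have h2 : latticeG2 Λ' = (z ^ 4)⁻¹ * latticeG2 Λ := by
    unfold latticeG2; rw [latticeG_smul Λ Λ' z hz h]; ring
  have h3 : latticeG3 Λ' = (z ^ 6)⁻¹ * latticeG3 Λ := by
    unfold latticeG3; rw [latticeG_smul Λ Λ' z hz h]; ring
  have hd : latticeDisc Λ' = (z ^ 12)⁻¹ * latticeDisc Λ := by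
    unfold latticeDisc; rw [h2, h3]; ring
  have hn : 2 ^ 6 * 3 ^ 3 * latticeG2 Λ' ^ 3
      = (z ^ 12)⁻¹ * (2 ^ 6 * 3 ^ 3 * latticeG2 Λ ^ 3) := by
    rw [h2]; ring
  unfold latticeJ
  rw [hn, hd, mul_div_mul_left _ _ (inv_ne_zero (pow_ne_zero _ hz))]

/-! ### Orders and their ideal classes -/

/-- A subring `R` of a number field `K` is an order of `K` if it is finitely generated as an
additive group and spans `K` over `ℚ`. -/
class IsNumberFieldOrder {K : Type*} [Field K] [NumberField K] (R : Subring K) : Prop where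
  finite : Module.Finite ℤ R
  span_eq_top : Submodule.span ℚ (R : Set K) = ⊤

section

variable {K : Type*} [Field K] {R : Subring K}

/-- The lattice in `ℂ` that a fractional ideal of `R` becomes under the embedding `φ`. -/
def idealLattice (φ : K →+* ℂ) (I : FractionalIdeal R⁰ K) : Submodule ℤ ℂ :=
  ((I : Submodule R K).restrictScalars ℤ).map (φ : K →+ ℂ).toIntLinearMap

lemma mem_idealLattice (φ : K →+* ℂ) (I : FractionalIdeal R⁰ K) (w : ℂ) :
    w ∈ idealLattice φ I ↔ ∃ a ∈ I, φ a = w := Iff.rfl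

end

section

variable {K : Type*} [Field K] [NumberField K] (R : Subring K) [IsNumberFieldOrder R]

/-- The field is the field of fractions of each of its orders. -/
instance IsNumberFieldOrder.isFractionRing : IsFractionRing R K := by
  have key : ∀ z : K, ∃ n : ℕ, n ≠ 0 ∧ (n : K) * z ∈ R := by
    intro z
    have hz : z ∈ Submodule.span ℚ (R : Set K) := by
      rw [IsNumberFieldOrder.span_eq_top]; trivial
    induction hz using Submodule.span_induction with
    | mem x hx => exact ⟨1, one_ne_zero, by simpa using hx⟩
    | zero => exact ⟨1, one_ne_zero, by simp [R.zero_mem]⟩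
    | add x y _ _ hx hy =>
      obtain ⟨m, hm, hmx⟩ := hx
      obtain ⟨n, hn, hny⟩ := hy
      refine ⟨m * n, mul_ne_zero hm hn, ?_⟩
      have : ((m * n : ℕ) : K) * (x + y) = (n : K) * ((m : K) * x) + (m : K) * ((n : K) * y) := by
        push_cast; ring
      rw [this]
      exact R.add_mem (R.mul_mem (natCast_mem R n) hmx) (R.mul_mem (natCast_mem R m) hny)
    | smul q x _ hx =>
      obtain ⟨m, hm, hmx⟩ := hx
      refine ⟨q.den * m, mul_ne_zero q.den_nz hm, ?_⟩
      have hq : (q.den : K) * (q : K) = (q.num : K) := by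
        have := Rat.den_mul_eq_num q
        exact_mod_cast congrArg (Rat.cast : ℚ → K) this
      have : ((q.den * m : ℕ) : K) * (q • x) = (q.num : K) * ((m : K) * x) := by
        rw [Rat.smul_def, ← hq]; push_cast; ring
      rw [this]
      exact R.mul_mem (intCast_mem R _) hmx
  refine IsFractionRing.of_field R K fun z => ?_
  obtain ⟨n, hn, hnz⟩ := key z
  refine ⟨⟨_, hnz⟩, ⟨n, natCast_mem R n⟩, ?_⟩
  have hn' : (n : K) ≠ 0 := Nat.cast_ne_zero.2 hn
  change _ = (n : K) * z / (n : K)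
  field_simp

variable {R}

lemma latticeJ_idealLattice_mul (φ : K →+* ℂ) (I : FractionalIdeal R⁰ K) (x : Kˣ) :
    latticeJ (idealLattice φ (I * FractionalIdeal.spanSingleton R⁰ (x : K)))
      = latticeJ (idealLattice φ I) := by
  refine latticeJ_smul _ _ (φ x) (by simp) fun w => ?_
  rw [mul_comm, mem_idealLattice]
  constructor
  · rintro ⟨a, ha, rfl⟩
    obtain ⟨b, hb, rfl⟩ := FractionalIdeal.mem_singleton_mul.1 ha
    exact ⟨φ b, ⟨b, hb, rfl⟩, map_mul _ _ _⟩
  · rintro ⟨_, ⟨b, hb, rfl⟩, rfl⟩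
    exact ⟨x * b, FractionalIdeal.mem_singleton_mul.2 ⟨b, hb, rfl⟩, map_mul _ _ _⟩

/-- The class invariant `j(𝔨)` of a class `𝔨` of invertible fractional ideals of the order `R`
modulo principal ones: the invariant of the lattice of any ideal in `𝔨`. -/
def classInvariant (φ : K →+* ℂ) (c : ClassGroup R) : ℂ :=
  Quotient.lift (s := QuotientGroup.leftRel (toPrincipalIdeal R K).range)
    (fun I : (FractionalIdeal R⁰ K)ˣ => latticeJ (idealLattice φ (I : FractionalIdeal R⁰ K)))
    (by
      intro I J h
      obtain ⟨x, hx⟩ := QuotientGroup.leftRel_apply.1 h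
      have hJ : J = I * toPrincipalIdeal R K x := by rw [hx]; group
      change latticeJ _ = latticeJ _
      rw [hJ, Units.val_mul, coe_toPrincipalIdeal, latticeJ_idealLattice_mul])
    (ClassGroup.equiv K c)

/-- The class invariant computed from an ideal in the class. -/
lemma classInvariant_mk (φ : K →+* ℂ) (I : (FractionalIdeal R⁰ K)ˣ) :
    classInvariant φ (ClassGroup.mk K I)
      = latticeJ (idealLattice φ (I : FractionalIdeal R⁰ K)) := by
  unfold classInvariant
  rw [ClassGroup.equiv_mk]
  simp

/-- If `α₁, α₂` is a basis of an ideal in the class and `ω = α₁ / α₂` lies in the upper half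
plane, the class invariant is `j(ω)`. -/
lemma classInvariant_mk_of_basis (φ : K →+* ℂ) (I : (FractionalIdeal R⁰ K)ˣ) (α₁ α₂ : K)
    (hI : ((I : FractionalIdeal R⁰ K) : Submodule R K).restrictScalars ℤ
      = Submodule.span ℤ {α₁, α₂})
    (ω : UpperHalfPlane) (hω : (ω : ℂ) = φ α₁ / φ α₂) :
    classInvariant φ (ClassGroup.mk K I) = modularJ ω := by
  have h2 : φ α₂ ≠ 0 := fun h => ω.ne_zero (by rw [hω, h, div_zero])
  have h1 : φ α₁ = φ α₂ * ω := by rw [hω]; field_simp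
  rw [classInvariant_mk]
  refine latticeJ_smul _ _ (φ α₂) h2 fun w => ?_
  unfold idealLattice
  rw [hI, Submodule.map_span, Set.image_pair]
  simp only [Submodule.mem_span_pair, AddMonoidHom.coe_toIntLinearMap, AddMonoidHom.coe_coe,
    zsmul_eq_mul]
  constructor
  · rintro ⟨a, b, rfl⟩
    exact ⟨_, ⟨a, b, rfl⟩, by rw [h1]; ring⟩
  · rintro ⟨_, ⟨a, b, rfl⟩, rfl⟩
    exact ⟨a, b, by rw [h1]; ring⟩

variable (R)

/-- The class polynomial `H_R(X) = ∏ (X - j(𝔨))`, the product over all ideal classes `𝔨` of `R`.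
(The finite product is meaningful because the class group of `R` is finite.) -/
def classPolynomial (φ : K →+* ℂ) : ℂ[X] :=
  ∏ᶠ c : ClassGroup R, (Polynomial.X - Polynomial.C (classInvariant φ c))

end

end

/-!
For a lattice `Λ = ℤ τ + ℤ`, the product of the differences `j(Λ) - j(Λ')` over the sublattices `Λ'`
of index `m`, other than `n Λ` when `m = n²`, is a polynomial `f_m` in `j(Λ)`, because it is
invariant under `SL(2, ℤ)` and meromorphic at the cusp. The `q`-expansion of `j` is integral, and
the factor of `Λ'` has an expansion whose coefficients lie in a cyclotomic ring; if `m` is not a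
square, the lowest coefficient of each factor is a unit of that ring. Hence `f_m` has rational
coefficients, its coefficients are algebraic integers and its leading coefficient is a unit: its
roots are algebraic integers. As `j` classifies lattices up to homothety, `j(Λ)` is a root of `f_m`
exactly if `Λ` has a multiplier of norm `m` that is not an integer times a multiplier of norm `1`.

The invertible ideals of `R` are lattices with ring of multipliers `R`, and every lattice with this
ring of multipliers is homothetic to one of them. Since `R` contains elements as above whose norm is
not a square, the class invariants are among the finitely many roots of one `f_m`.

An endomorphism `σ` of the field `ℂ` fixes each `f_m`, so the lattices with invariants `j` and
`σ(j)` have the same norms of multipliers in this sense. These norms determine an imaginary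
quadratic order of discriminant below `-4`, while for `-3` and `-4` the only invariants are `0` and
`1728`. Hence `σ` permutes the class invariants and fixes the class polynomial. The algebraic
integers fixed by all `σ` are the rational integers.
-/

noncomputable section

open UpperHalfPlane Complex Function ModularForm Filter
open scoped MatrixGroups Manifold Topology

/-! ### Expansions in powers of `exp (2πiτ/h)` -/

/-- `f` is the sum of the power series `P` in `exp (2πiτ/h)` on the upper half plane. -/
def HasQExp (h : ℝ) (P : PowerSeries ℂ) (f : ℍ → ℂ) : Prop :=
  ∀ τ : ℍ, HasSum (fun n => P.coeff n * Periodic.qParam h τ ^ n) (f τ)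

namespace HasQExp

variable {h : ℝ} {P Q : PowerSeries ℂ} {f g : ℍ → ℂ}

lemma sub (hf : HasQExp h P f) (hg : HasQExp h Q g) : HasQExp h (P - Q) (f - g) := fun τ => by
  simpa [sub_mul] using (hf τ).sub (hg τ)

lemma const (h : ℝ) (c : ℂ) : HasQExp h (PowerSeries.C c) (fun _ => c) := fun τ => by
  convert hasSum_ite_eq 0 c using 2 with n
  rcases eq_or_ne n 0 with rfl | hn
  · simp
  · simp [PowerSeries.coeff_C, hn]

lemma mul (hf : HasQExp h P f) (hg : HasQExp h Q g) : HasQExp h (P * Q) (f * g) := fun τ => by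
  have hf_norm := (hf τ).summable.norm
  have hg_norm := (hg τ).summable.norm
  have cauchy :=
    (summable_norm_sum_mul_antidiagonal_of_summable_norm hf_norm hg_norm).of_norm.hasSum
  rw [← tsum_mul_tsum_eq_tsum_sum_antidiagonal_of_summable_norm hf_norm hg_norm,
    (hf τ).tsum_eq, (hg τ).tsum_eq] at cauchy
  convert! cauchy using 2 with n
  rw [PowerSeries.coeff_mul, Finset.sum_mul]
  refine Finset.sum_congr rfl fun x hx => ?_
  rw [← Finset.HasAntidiagonal.mem_antidiagonal.1 hx, pow_add]
  ring

lemma smul (c : ℂ) (hf : HasQExp h P f) : HasQExp h (PowerSeries.C c * P) (fun τ => c * f τ) :=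
  (const h c).mul hf

lemma pow (hf : HasQExp h P f) (n : ℕ) : HasQExp h (P ^ n) (f ^ n) := by
  induction n with
  | zero => simpa using! const h 1
  | succ n ih => simpa [pow_succ] using ih.mul hf

lemma prod {ι : Type*} (s : Finset ι) {P : ι → PowerSeries ℂ} {f : ι → ℍ → ℂ}
    (hf : ∀ i ∈ s, HasQExp h (P i) (f i)) : HasQExp h (∏ i ∈ s, P i) (∏ i ∈ s, f i) := by
  classical
  induction s using Finset.induction_on with
  | empty => simpa using! const h 1
  | insert a s ha ih =>
    rw [Finset.prod_insert ha, Finset.prod_insert ha]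
    exact (hf a (by simp)).mul (ih fun i hi => hf i (by simp [hi]))

lemma X_pow (h : ℝ) (k : ℕ) :
    HasQExp h (PowerSeries.X ^ k) (fun τ => Periodic.qParam h τ ^ k) := fun τ => by
  convert hasSum_ite_eq k (Periodic.qParam h τ ^ k) using 2 with n
  rw [PowerSeries.coeff_X_pow]
  split_ifs with hn
  · simp [hn]
  · simp

lemma of_X_mul (hf : HasQExp h (PowerSeries.X * P) (fun τ => Periodic.qParam h τ * f τ)) :
    HasQExp h P f := fun τ => by
  have hq := Periodic.qParam_ne_zero (h := h) (τ : ℂ)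
  have hs := ((hasSum_nat_add_iff' 1).2 (hf τ)).mul_left (Periodic.qParam h τ)⁻¹
  simp only [PowerSeries.coeff_succ_X_mul, Finset.range_one, Finset.sum_singleton,
    PowerSeries.coeff_zero_X_mul, zero_mul, sub_zero, inv_mul_cancel_left₀ hq] at hs
  convert! hs using 2 with n
  field_simp
  ring

lemma exists_hasFPowerSeriesOnBall (hh : 0 < h) (hf : HasQExp h P f) :
    ∃ F : ℂ → ℂ, HasFPowerSeriesOnBall F (.ofScalars ℂ fun n => P.coeff n) 0 1 ∧
      ∀ τ : ℍ, f τ = F (Periodic.qParam h τ) := by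
  set p : FormalMultilinearSeries ℂ ℂ ℂ := .ofScalars ℂ fun n => P.coeff n
  have hrad : 1 ≤ p.radius := by
    refine le_of_forall_lt_imp_le_of_dense fun r hr => ?_
    rcases eq_or_ne r 0 with rfl | hr'
    · exact zero_le
    lift r to NNReal using hr.ne_top
    have hr1 : ‖((r : ℝ) : ℂ)‖ < 1 := by simpa using hr
    have hr0 : ((r : ℝ) : ℂ) ≠ 0 := by simpa using hr'
    have hs := (hf ⟨_, Periodic.im_invQParam_pos_of_norm_lt_one hh hr1 hr0⟩).summable.norm
    apply FormalMultilinearSeries.le_radius_of_summable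
    simpa [p, Periodic.qParam_right_inv hh.ne' hr0] using hs
  have hp := (p.hasFPowerSeriesOnBall (lt_of_lt_of_le one_pos hrad)).mono one_pos hrad
  refine ⟨p.sum, hp, fun τ => (hf τ).unique ?_⟩
  have hq : Periodic.qParam h τ ∈ Metric.eball 0 1 := by
    simpa [Metric.mem_eball, edist_zero_right, enorm_eq_nnnorm] using!
      Periodic.norm_qParam_lt_one hh τ.im_pos
  convert! zero_add (Periodic.qParam h τ) ▸ hp.hasSum hq using 2 with n
  simp [p, mul_comm]

lemma mdifferentiable (hh : 0 < h) (hf : HasQExp h P f) : MDiff f := by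
  obtain ⟨F, hF, hFf⟩ := hf.exists_hasFPowerSeriesOnBall hh
  rw [UpperHalfPlane.mdifferentiable_iff]
  have hdiff : DifferentiableOn ℂ (fun z => F (Periodic.qParam h z)) {z : ℂ | 0 < z.im} := by
    refine hF.differentiableOn.comp Periodic.differentiable_qParam.differentiableOn fun z hz => ?_
    simpa [Metric.mem_eball, edist_zero_right, enorm_eq_nnnorm] using!
      Periodic.norm_qParam_lt_one hh hz
  refine hdiff.congr fun z hz => ?_
  simp [hFf, UpperHalfPlane.ofComplex_apply_of_im_pos hz]

lemma tendsto (hh : 0 < h) (hf : HasQExp h P f) :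
    Tendsto f atImInfty (𝓝 (PowerSeries.constantCoeff P)) := by
  obtain ⟨F, hF, hFf⟩ := hf.exists_hasFPowerSeriesOnBall hh
  have h0 : F 0 = PowerSeries.constantCoeff P := by
    simpa using (hF.hasFPowerSeriesAt.coeff_zero 1).symm
  rw [funext hFf, ← h0]
  exact hF.hasFPowerSeriesAt.continuousAt.tendsto.comp (qParam_tendsto_atImInfty hh)

lemma isBoundedAtImInfty (hh : 0 < h) (hf : HasQExp h P f) : IsBoundedAtImInfty f :=
  (hf.tendsto hh).isBigO_one ℝ

lemma periodic (hh : 0 < h) (hf : HasQExp h P f) : Periodic (f ∘ ofComplex) (h : ℂ) := fun w => by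
  obtain ⟨F, -, hFf⟩ := hf.exists_hasFPowerSeriesOnBall hh
  by_cases hw : 0 < w.im
  · have hw' : 0 < (w + h).im := by simpa using hw
    have hq : Periodic.qParam h (w + h) = Periodic.qParam h w := by
      simp [Periodic.qParam, mul_add, add_div, Complex.exp_add, hh.ne']
    simp only [comp_apply, hFf, ofComplex_apply_of_im_pos hw, ofComplex_apply_of_im_pos hw',
      hq]
  · have hw' : (w + h).im ≤ 0 := by simpa using hw
    rw [comp_apply, comp_apply, ofComplex_apply_of_im_nonpos (not_lt.1 hw),
      ofComplex_apply_of_im_nonpos hw']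

lemma of_periodic (hh : 0 < h) (hper : Periodic (f ∘ ofComplex) (h : ℂ)) (hhol : MDiff f)
    (hbdd : IsBoundedAtImInfty f) : HasQExp h (qExpansion h f) f := fun τ => by
  simpa using UpperHalfPlane.hasSum_qExpansion hh hper hhol hbdd τ

lemma unique (hh : 0 < h) (hP : HasQExp h P f) (hQ : HasQExp h Q f) : P = Q := by
  have hF {R : PowerSeries ℂ} (hR : HasQExp h R f) :=
    (hasFPowerSeriesOnBall_cuspFunction hh (analyticAt_cuspFunction_zero hh (hR.periodic hh)
      (hR.mdifferentiable hh) (hR.isBoundedAtImInfty hh)) hR).hasFPowerSeriesAt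
  ext n
  simpa using congrArg (FormalMultilinearSeries.coeff · n)
    ((hF hP).eq_formalMultilinearSeries (hF hQ))

lemma inv (hh : 0 < h) (hf : HasQExp h P f) (h0 : PowerSeries.constantCoeff P ≠ 0)
    (hne : ∀ τ, f τ ≠ 0) : HasQExp h P⁻¹ f⁻¹ := by
  have hper : Periodic (f⁻¹ ∘ ofComplex) (h : ℂ) := (hf.periodic hh).comp Inv.inv
  have hhol : MDiff f⁻¹ := by
    simpa [div_eq_mul_inv, ← Pi.one_def] using
      ((HasQExp.const h 1).mdifferentiable hh).div (hf.mdifferentiable hh) hne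
  have hinv := HasQExp.of_periodic hh hper hhol (((hf.tendsto hh).inv₀ h0).isBigO_one ℝ)
  have hone : f⁻¹ * f = fun _ => 1 := funext fun τ => inv_mul_cancel₀ (hne τ)
  have hmul : qExpansion h f⁻¹ * P = 1 := by
    simpa using (hone ▸ hinv.mul hf).unique hh (const h 1)
  rwa [(PowerSeries.eq_inv_iff_mul_eq_one h0).2 hmul] at hinv

end HasQExp

lemma eq_const_of_invariant {f : ℍ → ℂ} (hf : MDiff f) (hb : IsBoundedAtImInfty f)
    (hinv : ∀ (γ : SL(2, ℤ)) (τ : ℍ), f (γ • τ) = f τ) : ∃ c, f = fun _ => c := by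
  have hs : ∀ γ : SL(2, ℤ), f ∣[(0 : ℤ)] γ = f := fun γ => by
    ext τ
    rw [SL_slash_apply, hinv, neg_zero, zpow_zero, mul_one]
  let F : ModularForm 𝒮ℒ 0 :=
    { toFun := f
      slash_action_eq' := fun _ ⟨γ, hγ⟩ => hγ ▸ hs γ
      holo' := hf
      bdd_at_cusps' := fun {c} hc => by
        rw [Subgroup.IsArithmetic.isCusp_iff_isCusp_SL2Z] at hc
        rw [OnePoint.isBoundedAt_iff_forall_SL2Z hc]
        intro γ _
        rw [hs γ]
        exact hb }
  exact ModularFormClass.levelOne_weight_zero_const F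

lemma HasQExp.eq_zero_of_invariant {f : ℍ → ℂ} {P : PowerSeries ℂ} (hf : HasQExp 1 P f)
    (h0 : PowerSeries.constantCoeff P = 0)
    (hinv : ∀ (γ : SL(2, ℤ)) (τ : ℍ), f (γ • τ) = f τ) : f = 0 := by
  obtain ⟨c, rfl⟩ := eq_const_of_invariant (hf.mdifferentiable one_pos)
    (hf.isBoundedAtImInfty one_pos) hinv
  rw [hf.unique one_pos (HasQExp.const 1 c), PowerSeries.constantCoeff_C] at h0
  exact funext fun _ => h0

/-! ### The modular function `j` -/

/-- The lattice `ℤ τ + ℤ`. -/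
def upperLattice (τ : ℍ) : Submodule ℤ ℂ := Submodule.span ℤ {(τ : ℂ), 1}

lemma mem_upperLattice {τ : ℍ} {w : ℂ} : w ∈ upperLattice τ ↔ ∃ m n : ℤ, w = m * τ + n := by
  simp [upperLattice, Submodule.mem_span_pair, eq_comm]

lemma linearIndependent_pair_of_im_ne_zero {z : ℂ} (hz : z.im ≠ 0) :
    LinearIndependent ℝ ![z, 1] := by
  refine LinearIndependent.pair_iff.2 fun s t h => ?_
  have him : s * z.im = 0 := by simpa using congrArg Complex.im h
  obtain rfl : s = 0 := (mul_eq_zero.1 him).resolve_right hz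
  exact ⟨rfl, by simpa using h⟩

/-- The pair of periods `τ, 1`, through which the theory of the Weierstrass `℘`-function applies
to the lattice `ℤ τ + ℤ`. -/
def upperPeriodPair (τ : ℍ) : PeriodPair where
  ω₁ := τ
  ω₂ := 1
  indep := linearIndependent_pair_of_im_ne_zero τ.im_ne_zero

lemma latticeG_upperLattice_eq_tsum (τ : ℍ) (k : ℕ) :
    latticeG (upperLattice τ) k = ∑' v : Fin 2 → ℤ, EisensteinSeries.eisSummand k v τ := by
  let e := (finTwoArrowEquiv ℤ).trans (upperPeriodPair τ).latticeEquivProd.symm.toEquiv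
  change ∑' w : (upperPeriodPair τ).lattice, ((w : ℂ) ^ k)⁻¹ = _
  rw [← e.tsum_eq]
  refine tsum_congr fun v => ?_
  have hv : ((e v : (upperPeriodPair τ).lattice) : ℂ) = v 0 * τ + v 1 :=
    (PeriodPair.latticeEquiv_symm_apply _ (v 0, v 1)).trans (by simp [upperPeriodPair])
  rw [hv, EisensteinSeries.eisSummand, zpow_neg, zpow_natCast]

lemma latticeG_upperLattice (τ : ℍ) {k : ℕ} (hk : 3 ≤ k) :
    latticeG (upperLattice τ) k = 2 * riemannZeta k * E hk τ := by
  rw [latticeG_upperLattice_eq_tsum,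
    tsum_eisSummand_eq_riemannZeta_mul_eisensteinSeries hk,
    show E hk τ = (1 / 2 : ℂ) • EisensteinSeries.eisensteinSeriesSIF (N := 1) 0 k τ from rfl,
    EisensteinSeries.eisensteinSeriesSIF_apply, smul_eq_mul]
  ring

lemma bernoulli_four : bernoulli 4 = -1 / 30 := by decide +kernel

lemma bernoulli_six : bernoulli 6 = 1 / 42 := by decide +kernel

lemma riemannZeta_six : riemannZeta 6 = Real.pi ^ 6 / 945 := by
  have h := riemannZeta_two_mul_nat (k := 3) (by norm_num)
  norm_num [bernoulli_six, Nat.factorial] at h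
  rw [h]
  ring

lemma latticeG2_upperLattice (τ : ℍ) :
    latticeG2 (upperLattice τ) = 4 / 3 * Real.pi ^ 4 * E₄ τ := by
  rw [latticeG2, latticeG_upperLattice τ (k := 4) (by norm_num), Nat.cast_ofNat, riemannZeta_four]
  ring

lemma latticeG3_upperLattice (τ : ℍ) :
    latticeG3 (upperLattice τ) = 8 / 27 * Real.pi ^ 6 * E₆ τ := by
  rw [latticeG3, latticeG_upperLattice τ (k := 6) (by norm_num), Nat.cast_ofNat, riemannZeta_six]
  ring

lemma latticeDisc_upperLattice (τ : ℍ) :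
    latticeDisc (upperLattice τ) = 4096 * Real.pi ^ 12 * discriminant τ := by
  rw [latticeDisc, latticeG2_upperLattice, latticeG3_upperLattice,
    discriminant_eq_E₄_cube_sub_E₆_sq]
  ring

lemma latticeDisc_upperLattice_ne_zero (τ : ℍ) : latticeDisc (upperLattice τ) ≠ 0 := by
  rw [latticeDisc_upperLattice]
  exact mul_ne_zero (mul_ne_zero (by norm_num) (pow_ne_zero _ (by simp))) (discriminant_ne_zero τ)

lemma modularJ_eq (τ : ℍ) : modularJ τ = E₄ τ ^ 3 / discriminant τ := by
  change latticeJ (upperLattice τ) = _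
  rw [latticeJ, latticeG2_upperLattice, latticeDisc_upperLattice]
  have hΔ := discriminant_ne_zero τ
  have hπ := Complex.ofReal_ne_zero.2 Real.pi_ne_zero
  field_simp
  ring

lemma modularJ_smul (γ : SL(2, ℤ)) (τ : ℍ) : modularJ (γ • τ) = modularJ τ := by
  have hγ : Matrix.SpecialLinearGroup.mapGL ℝ γ ∈ 𝒮ℒ := ⟨γ, rfl⟩
  have h4 : E₄ (γ • τ) = _ := SlashInvariantForm.slash_action_eqn' (k := 4) E₄ hγ τ
  have hΔ : discriminant (γ • τ) = _ * discriminant τ :=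
    SlashInvariantForm.slash_action_eqn' (k := 12) CuspForm.discriminant hγ τ
  have hne := discriminant_ne_zero (γ • τ)
  rw [hΔ] at hne
  rw [modularJ_eq, modularJ_eq, h4, hΔ, mul_pow, ← zpow_natCast, ← zpow_mul]
  exact mul_div_mul_left _ _ (left_ne_zero_of_mul hne)

/-! ### The `q`-expansion of `j` -/

lemma constantCoeff_map_eq {R S : Type*} [Semiring R] [Semiring S] (f : R →+* S)
    (P : PowerSeries R) :
    PowerSeries.constantCoeff (P.map f) = f (PowerSeries.constantCoeff P) :=
  MvPowerSeries.constantCoeff_map f P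

/-- The series `∑ σ_k(n) Xⁿ`, which carries the `q`-expansions of Eisenstein series. -/
def sigmaSeries (k : ℕ) : PowerSeries ℤ :=
  PowerSeries.mk fun n => (ArithmeticFunction.sigma k n : ℤ)

/-- The `q`-expansion of `E₄`. -/
def e4Series : PowerSeries ℤ := 1 + (240 : ℤ) • sigmaSeries 3

/-- The `q`-expansion of `E₆`. -/
def e6Series : PowerSeries ℤ := 1 - (504 : ℤ) • sigmaSeries 5

lemma constantCoeff_sigmaSeries (k : ℕ) : PowerSeries.constantCoeff (sigmaSeries k) = 0 := by
  simp [sigmaSeries, ← PowerSeries.coeff_zero_eq_constantCoeff_apply]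

lemma constantCoeff_e4Series : PowerSeries.constantCoeff e4Series = 1 := by
  simp [e4Series, constantCoeff_sigmaSeries]

lemma hasQExp_qExpansion {k : ℤ} (f : ModularForm 𝒮ℒ k) :
    HasQExp 1 (qExpansion 1 f) f := fun τ => by
  simpa using ModularForm.hasSum_qExpansion f one_pos one_mem_strictPeriods_SL τ

lemma hasQExp_E₄ : HasQExp 1 (e4Series.map (Int.castRingHom ℂ)) E₄ := by
  have h : e4Series.map (Int.castRingHom ℂ) = qExpansion 1 E₄ := by
    ext n
    rw [EisensteinSeries.E_qExpansion_coeff _ ⟨2, rfl⟩, bernoulli_four, PowerSeries.coeff_map,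
      e4Series, map_add, map_zsmul, sigmaSeries, PowerSeries.coeff_mk, PowerSeries.coeff_one]
    split_ifs with hn
    · simp [hn]
    · norm_num
  exact h ▸ hasQExp_qExpansion E₄

lemma hasQExp_E₆ : HasQExp 1 (e6Series.map (Int.castRingHom ℂ)) E₆ := by
  have h : e6Series.map (Int.castRingHom ℂ) = qExpansion 1 E₆ := by
    ext n
    rw [EisensteinSeries.E_qExpansion_coeff _ ⟨3, rfl⟩, bernoulli_six, PowerSeries.coeff_map,
      e6Series, map_sub, map_zsmul, sigmaSeries, PowerSeries.coeff_mk, PowerSeries.coeff_one]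
    split_ifs with hn
    · simp [hn]
    · norm_num
  exact h ▸ hasQExp_qExpansion E₆

lemma twelve_dvd_five_sigma_three_add_seven_sigma_five (n : ℕ) : (12 : ℤ) ∣
    5 * (ArithmeticFunction.sigma 3 n : ℤ) + 7 * (ArithmeticFunction.sigma 5 n : ℤ) := by
  rw [ArithmeticFunction.sigma_apply, ArithmeticFunction.sigma_apply]
  push_cast
  rw [Finset.mul_sum, Finset.mul_sum, ← Finset.sum_add_distrib]
  refine Finset.dvd_sum fun d _ => (ZMod.intCast_zmod_eq_zero_iff_dvd _ 12).1 ?_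
  have h : ∀ x : ZMod 12, 5 * x ^ 3 + 7 * x ^ 5 = 0 := by decide
  exact_mod_cast h (d : ZMod 12)

/-- The `q`-expansion `(E₄³ - E₆²) / 1728` of `Δ`, with the division carried out in terms of
`A = ∑ σ₃(n) qⁿ` and `B = ∑ σ₅(n) qⁿ`: it is
`(5 A + 7 B) / 12 + 100 A² + 8000 A³ - 147 B²`. -/
def deltaSeries : PowerSeries ℤ :=
  PowerSeries.mk (fun n =>
      (5 * (ArithmeticFunction.sigma 3 n : ℤ) + 7 * (ArithmeticFunction.sigma 5 n : ℤ)) / 12) +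
    (100 : ℤ) • sigmaSeries 3 ^ 2 + (8000 : ℤ) • sigmaSeries 3 ^ 3 - (147 : ℤ) • sigmaSeries 5 ^ 2

/-- The power series `D` such that `Δ = q D(q)`. -/
def discSeries : PowerSeries ℤ := PowerSeries.mk fun n => deltaSeries.coeff (n + 1)

/-- The power series with integral coefficients whose sum is `q j`. -/
def jSeries : PowerSeries ℤ := e4Series ^ 3 * PowerSeries.invOfUnit discSeries 1

lemma deltaSeries_eq : (1728 : ℤ) • deltaSeries = e4Series ^ 3 - e6Series ^ 2 := by
  have hlin : (12 : ℤ) • PowerSeries.mk (fun n =>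
      (5 * (ArithmeticFunction.sigma 3 n : ℤ) + 7 * (ArithmeticFunction.sigma 5 n : ℤ)) / 12) =
        (5 : ℤ) • sigmaSeries 3 + (7 : ℤ) • sigmaSeries 5 := by
    ext n
    simpa [sigmaSeries, -zsmul_eq_mul] using
      Int.mul_ediv_cancel' (twelve_dvd_five_sigma_three_add_seven_sigma_five n)
  simp only [deltaSeries, e4Series, e6Series, zsmul_eq_mul, Int.cast_ofNat] at hlin ⊢
  linear_combination 144 * hlin

lemma X_mul_discSeries : PowerSeries.X * discSeries = deltaSeries := by
  ext n
  cases n with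
  | zero =>
    simp [deltaSeries, constantCoeff_sigmaSeries]
  | succ n => rw [PowerSeries.coeff_succ_X_mul, discSeries, PowerSeries.coeff_mk]

lemma coeff_one_pow_of_constantCoeff_eq_zero {R : Type*} [CommRing R] {F : PowerSeries R}
    (hF : PowerSeries.constantCoeff F = 0) {k : ℕ} (hk : 1 < k) : (F ^ k).coeff 1 = 0 := by
  obtain ⟨G, rfl⟩ := PowerSeries.X_dvd_iff.2 hF
  rw [mul_pow, PowerSeries.coeff_X_pow_mul', if_neg (by lia)]

lemma constantCoeff_discSeries : PowerSeries.constantCoeff discSeries = 1 := by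
  have h (k : ℕ) {n : ℕ} (hn : 1 < n) : (sigmaSeries k ^ n).coeff 1 = 0 :=
    coeff_one_pow_of_constantCoeff_eq_zero (constantCoeff_sigmaSeries k) hn
  rw [← PowerSeries.coeff_zero_eq_constantCoeff_apply, discSeries, PowerSeries.coeff_mk, zero_add,
    deltaSeries]
  simp [h, -zsmul_eq_mul]

lemma jSeries_mul_discSeries : jSeries * discSeries = e4Series ^ 3 := by
  rw [jSeries, mul_assoc, mul_comm (PowerSeries.invOfUnit _ _),
    PowerSeries.mul_invOfUnit _ _ (by simp [constantCoeff_discSeries]), mul_one]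

lemma constantCoeff_jSeries : PowerSeries.constantCoeff jSeries = 1 := by
  simp [jSeries, constantCoeff_e4Series]

lemma hasQExp_discriminant : HasQExp 1 (deltaSeries.map (Int.castRingHom ℂ)) discriminant := by
  have hmap := congrArg (PowerSeries.map (Int.castRingHom ℂ)) deltaSeries_eq
  simp only [map_sub, map_pow, map_mul, zsmul_eq_mul, Int.cast_ofNat, map_ofNat] at hmap
  have hC : PowerSeries.C (1728⁻¹ : ℂ) * 1728 = 1 := by
    rw [show (1728 : PowerSeries ℂ) = PowerSeries.C 1728 from (map_ofNat _ _).symm, ← map_mul]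
    norm_num
  convert ((hasQExp_E₄.pow 3).sub (hasQExp_E₆.pow 2)).smul 1728⁻¹ using 1
  · linear_combination PowerSeries.C (1728⁻¹ : ℂ) * hmap -
      deltaSeries.map (Int.castRingHom ℂ) * hC
  · ext τ
    simp [discriminant_eq_E₄_cube_sub_E₆_sq, div_eq_inv_mul]

lemma hasQExp_modularJ : HasQExp 1 (jSeries.map (Int.castRingHom ℂ))
    (fun τ => Periodic.qParam 1 τ * modularJ τ) := by
  have hq (τ : ℍ) : Periodic.qParam 1 (τ : ℂ) ≠ 0 := Periodic.qParam_ne_zero _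
  have hD : HasQExp 1 (discSeries.map (Int.castRingHom ℂ))
      (fun τ => discriminant τ / Periodic.qParam 1 τ) := by
    refine HasQExp.of_X_mul ?_
    convert hasQExp_discriminant using 1
    · rw [← X_mul_discSeries, map_mul, PowerSeries.map_X]
    · exact funext fun τ => mul_div_cancel₀ _ (hq τ)
  have hD0 : PowerSeries.constantCoeff (discSeries.map (Int.castRingHom ℂ)) ≠ 0 := by
    simp [constantCoeff_map_eq, constantCoeff_discSeries]
  convert (hasQExp_E₄.pow 3).mul
    (hD.inv one_pos hD0 fun τ => div_ne_zero (discriminant_ne_zero τ) (hq τ)) using 1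
  · rw [PowerSeries.eq_mul_inv_iff_mul_eq hD0, ← map_mul, jSeries_mul_discSeries, map_pow]
  · ext τ
    simp only [modularJ_eq, Pi.mul_apply, Pi.pow_apply, Pi.inv_apply, inv_div]
    ring

lemma exists_modularJ_eq (y : ℂ) : ∃ τ, modularJ τ = y := by
  by_contra! hy
  have hne (τ : ℍ) : E₄ τ ^ 3 - y * discriminant τ ≠ 0 := fun h => hy τ <| by
    rw [modularJ_eq, div_eq_iff (discriminant_ne_zero τ)]
    linear_combination h
  have hD : HasQExp 1 _ (fun τ => E₄ τ ^ 3 - y * discriminant τ) :=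
    (hasQExp_E₄.pow 3).sub (hasQExp_discriminant.smul y)
  have hΔ0 : PowerSeries.constantCoeff (deltaSeries.map (Int.castRingHom ℂ)) = 0 := by
    simp [constantCoeff_map_eq, ← X_mul_discSeries]
  -- If `j` omits `y`, then `1 / (j - y) = Δ / (E₄³ - y Δ)` is holomorphic and vanishes at `i∞`.
  have hj (τ : ℍ) : discriminant τ * (E₄ τ ^ 3 - y * discriminant τ)⁻¹ = (modularJ τ - y)⁻¹ := by
    rw [modularJ_eq, div_sub' (discriminant_ne_zero τ), inv_div, div_eq_mul_inv, mul_comm _ y]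
  have hzero := (hasQExp_discriminant.mul (hD.inv one_pos
    (by simp [constantCoeff_map_eq, constantCoeff_e4Series, hΔ0]) hne)).eq_zero_of_invariant
    (by simp [hΔ0]) fun γ τ => by simp only [Pi.mul_apply, Pi.inv_apply, hj, modularJ_smul]
  exact mul_ne_zero (discriminant_ne_zero _) (inv_ne_zero (hne _)) (congrFun hzero UpperHalfPlane.I)

/-! ### Polynomials in `j` -/

section jPoly

variable {A B : Type*} [CommRing A] [CommRing B]

/-- The series `R` with `q⁻ᴺ P - c jᴺ = q⁻ᴺ⁺¹ R`, where `c` is the constant coefficient of `P`: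
subtracting `c jᴺ` lowers the order of the pole by one. -/
def jRemainder (N : ℕ) (P : PowerSeries A) : PowerSeries A :=
  PowerSeries.mk fun n => (P - PowerSeries.C (PowerSeries.constantCoeff P) *
    (jSeries.map (Int.castRingHom A)) ^ N).coeff (n + 1)

/-- The polynomial `f` such that `f(j)` and `q⁻ᴺ P(q)` have the same polar part and the same
constant term. -/
def jPoly : ℕ → PowerSeries A → A[X]
  | 0, P => Polynomial.C (PowerSeries.constantCoeff P)
  | N + 1, P => Polynomial.monomial (N + 1) (PowerSeries.constantCoeff P) +
      jPoly N (jRemainder (N + 1) P)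

lemma X_mul_jRemainder (N : ℕ) (P : PowerSeries A) :
    PowerSeries.X * jRemainder N P = P - PowerSeries.C (PowerSeries.constantCoeff P) *
      (jSeries.map (Int.castRingHom A)) ^ N := by
  ext n
  cases n with
  | zero => simp [constantCoeff_map_eq, constantCoeff_jSeries]
  | succ n => rw [PowerSeries.coeff_succ_X_mul, jRemainder, PowerSeries.coeff_mk]

lemma map_jRemainder (f : A →+* B) (N : ℕ) (P : PowerSeries A) :
    (jRemainder N P).map f = jRemainder N (P.map f) := by
  have hj : (jSeries.map (Int.castRingHom A)).map f = jSeries.map (Int.castRingHom B) := by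
    ext n
    simp [PowerSeries.coeff_map]
  ext n
  rw [PowerSeries.coeff_map, jRemainder, jRemainder, PowerSeries.coeff_mk, PowerSeries.coeff_mk,
    ← PowerSeries.coeff_map, map_sub, map_mul, map_pow, hj, PowerSeries.map_C,
    constantCoeff_map_eq]

lemma map_jPoly (f : A →+* B) (N : ℕ) (P : PowerSeries A) :
    (jPoly N P).map f = jPoly N (P.map f) := by
  induction N generalizing P with
  | zero => simp [jPoly, constantCoeff_map_eq]
  | succ N ih =>
    rw [jPoly, jPoly, Polynomial.map_add, Polynomial.map_monomial, ih, map_jRemainder,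
      constantCoeff_map_eq]

lemma natDegree_jPoly_le (N : ℕ) (P : PowerSeries A) : (jPoly N P).natDegree ≤ N := by
  induction N generalizing P with
  | zero => simp [jPoly]
  | succ N ih =>
    exact Polynomial.natDegree_add_le_of_degree_le (Polynomial.natDegree_monomial_le _)
      ((ih _).trans N.le_succ)

lemma coeff_jPoly (N : ℕ) (P : PowerSeries A) :
    (jPoly N P).coeff N = PowerSeries.constantCoeff P := by
  cases N with
  | zero => simp [jPoly]
  | succ N =>
    rw [jPoly, Polynomial.coeff_add, Polynomial.coeff_monomial_same,
      Polynomial.coeff_eq_zero_of_natDegree_lt (Nat.lt_succ_of_le (natDegree_jPoly_le _ _)),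
      add_zero]

lemma jPoly_X_pow_mul (k N : ℕ) (P : PowerSeries A) :
    jPoly (N + k) (PowerSeries.X ^ k * P) = jPoly N P := by
  induction k with
  | zero => simp
  | succ k ih =>
    have h0 : PowerSeries.constantCoeff (PowerSeries.X ^ (k + 1) * P) = 0 := by simp
    have hrem (M : ℕ) :
        jRemainder M (PowerSeries.X ^ (k + 1) * P) = PowerSeries.X ^ k * P := by
      refine PowerSeries.X_mul_cancel ?_
      rw [X_mul_jRemainder, h0, map_zero, zero_mul, sub_zero, pow_succ', mul_assoc]
    rw [← add_assoc, jPoly, h0, hrem, ih, map_zero, zero_add]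

end jPoly

lemma eq_eval_jPoly {N : ℕ} {P : PowerSeries ℂ} {F : ℍ → ℂ}
    (hF : HasQExp 1 P (fun τ => Periodic.qParam 1 τ ^ N * F τ))
    (hinv : ∀ (γ : SL(2, ℤ)) (τ : ℍ), F (γ • τ) = F τ) (τ : ℍ) :
    F τ = (jPoly N P).eval (modularJ τ) := by
  induction N generalizing P F with
  | zero =>
    simp only [pow_zero, one_mul] at hF
    have h := (hF.sub (HasQExp.const 1 (PowerSeries.constantCoeff P))).eq_zero_of_invariant
      (by simp) fun γ τ => by rw [Pi.sub_apply, Pi.sub_apply, hinv]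
    simpa [jPoly, sub_eq_zero] using congrFun h τ
  | succ N ih =>
    have hR : HasQExp 1 (jRemainder (N + 1) P) (fun τ => Periodic.qParam 1 τ ^ N *
        (F τ - PowerSeries.constantCoeff P * modularJ τ ^ (N + 1))) := by
      refine HasQExp.of_X_mul ?_
      rw [X_mul_jRemainder]
      convert! hF.sub ((hasQExp_modularJ.pow (N + 1)).smul (PowerSeries.constantCoeff P)) using 1
      ext τ
      simp only [Pi.sub_apply, Pi.pow_apply]
      ring
    have h := ih hR fun γ τ => by rw [hinv, modularJ_smul]
    rw [jPoly, Polynomial.eval_add, Polynomial.eval_monomial, ← h]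
    ring

/-! ### Lattices with the same invariants -/

/-- The differential equation `℘'² = 4 ℘³ - a ℘ - b` near the origin for `℘ = z⁻² + f`, multiplied
by `z⁶` so that it makes sense for a function `f` which is analytic at `0`. -/
def SatisfiesWeierstrassEquation (a b : ℂ) (f : ℂ → ℂ) : Prop :=
  ∀ᶠ z in 𝓝[≠] (0 : ℂ), (z ^ 3 * deriv f z - 2) ^ 2
    = 4 * (z ^ 2 * f z + 1) ^ 3 - a * z ^ 4 * (z ^ 2 * f z + 1) - b * z ^ 6

lemma satisfiesWeierstrassEquation_weierstrassPExcept (L : PeriodPair) :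
    SatisfiesWeierstrassEquation L.g₂ L.g₃ (L.weierstrassPExcept 0) := by
  filter_upwards [self_mem_nhdsWithin,
    nhdsWithin_le_nhds (L.compl_lattice_sdiff_singleton_mem_nhds 0)] with z (hz0 : z ≠ 0) hz
  have h := L.derivWeierstrassP_sq z fun h => hz ⟨h, hz0⟩
  rw [← L.weierstrassPExcept_add 0 z, ← L.derivWeierstrassPExcept_sub 0 z] at h
  rw [L.eqOn_deriv_weierstrassPExcept_derivWeierstrassPExcept 0 hz]
  simp only [ZeroMemClass.coe_zero, sub_zero, ne_eq, OfNat.ofNat_ne_zero, not_false_eq_true,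
    zero_pow, div_zero] at h
  have h6 := congrArg (· * z ^ 6) h
  field_simp at h6
  linear_combination h6

lemma eventually_mul_deriv_eq {f g : ℂ → ℂ} {n : ℕ} (hg : AnalyticAt ℂ g 0)
    (hfg : f =ᶠ[𝓝 0] fun z => z ^ n * g z) :
    ∀ᶠ z in 𝓝 (0 : ℂ), z * deriv f z = z ^ n * (n * g z + z * deriv g z) := by
  filter_upwards [hfg.deriv, hg.eventually_analyticAt] with z hz hgz
  rw [hz, deriv_fun_mul (by fun_prop) hgz.differentiableAt]
  cases n with
  | zero => simp
  | succ n =>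
    simp only [deriv_fun_pow, differentiableAt_fun_id, deriv_id'', Nat.add_sub_cancel]
    ring

lemma SatisfiesWeierstrassEquation.eventuallyEq {a b : ℂ} {f k : ℂ → ℂ} (hf : AnalyticAt ℂ f 0)
    (hk : AnalyticAt ℂ k 0) (ef : SatisfiesWeierstrassEquation a b f)
    (ek : SatisfiesWeierstrassEquation a b k) : f =ᶠ[𝓝 0] k := by
  suffices h : ∀ᶠ z in 𝓝 0, (f - k) z = 0 by simpa [EventuallyEq, sub_eq_zero] using h
  by_contra hne
  obtain ⟨n, g, hg, hg0, hgz⟩ := (hf.sub hk).exists_eventuallyEq_pow_smul_nonzero_iff.2 hne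
  simp only [sub_zero, smul_eq_mul] at hgz
  -- The difference of the two equations, divided by the power `z ^ (n + 2)` occurring in it.
  let l : ℂ → ℂ := fun z => (n * g z + z * deriv g z) * (z ^ 3 * (deriv f z + deriv k z) - 4)
  let r : ℂ → ℂ := fun z => g z * (4 * ((z ^ 2 * f z + 1) ^ 2
    + (z ^ 2 * f z + 1) * (z ^ 2 * k z + 1) + (z ^ 2 * k z + 1) ^ 2) - a * z ^ 4)
  have hlr : l =ᶠ[𝓝[≠] 0] r := by
    filter_upwards [self_mem_nhdsWithin, ef, ek,
      nhdsWithin_le_nhds (eventually_mul_deriv_eq hg hgz), nhdsWithin_le_nhds hgz,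
      nhdsWithin_le_nhds hf.eventually_analyticAt, nhdsWithin_le_nhds hk.eventually_analyticAt]
      with z (hz0 : z ≠ 0) efz ekz hdz hgz hfz hkz
    rw [deriv_sub hfz.differentiableAt hkz.differentiableAt] at hdz
    rw [Pi.sub_apply] at hgz
    refine mul_left_cancel₀ (pow_ne_zero (n + 2) hz0) ?_
    linear_combination efz - ekz
      - z ^ 2 * (z ^ 3 * (deriv f z + deriv k z) - 4) * hdz
      + z ^ 2 * (4 * ((z ^ 2 * f z + 1) ^ 2
        + (z ^ 2 * f z + 1) * (z ^ 2 * k z + 1) + (z ^ 2 * k z + 1) ^ 2) - a * z ^ 4) * hgz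
  have hlr0 : l 0 = r 0 := by
    have hgc := hg.continuousAt
    have hgc' := hg.deriv.continuousAt
    have hfc := hf.continuousAt
    have hfc' := hf.deriv.continuousAt
    have hkc := hk.continuousAt
    have hkc' := hk.deriv.continuousAt
    have hl : ContinuousAt l 0 := by fun_prop
    have hr : ContinuousAt r 0 := by fun_prop
    exact ((hl.eventuallyEq_nhds_iff_eventuallyEq_nhdsNE hr).1 hlr).eq_of_nhds
  have hng : ((n : ℂ) + 3) * g 0 = 0 := by
    simp only [l, r] at hlr0
    linear_combination (-1 / 4) * hlr0
  exact mul_ne_zero (by exact_mod_cast Nat.succ_ne_zero (n + 2)) hg0 hng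

lemma countable_lattice (L : PeriodPair) : (L.lattice : Set ℂ).Countable :=
  Set.countable_coe_iff.1 (L.latticeEquivProd.toEquiv.countable_iff.2 inferInstance)

lemma eqOn_weierstrassP_of_invariants_eq {L L' : PeriodPair} (h2 : L.g₂ = L'.g₂)
    (h3 : L.g₃ = L'.g₃) :
    Set.EqOn L.weierstrassP L'.weierstrassP ((L.lattice : Set ℂ) ∪ L'.lattice)ᶜ := by
  have hconn : IsPreconnected ((L.lattice : Set ℂ) ∪ L'.lattice)ᶜ :=
    (((countable_lattice L).union (countable_lattice L')).isPathConnected_compl_of_one_lt_rank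
      (by simp [Complex.rank_real_complex])).isConnected.isPreconnected
  have heq := SatisfiesWeierstrassEquation.eventuallyEq (L.analyticAt_weierstrassPExcept 0)
    (L'.analyticAt_weierstrassPExcept 0) (satisfiesWeierstrassEquation_weierstrassPExcept L)
    (by rw [h2, h3]; exact satisfiesWeierstrassEquation_weierstrassPExcept L')
  have hnear : ∀ᶠ z in 𝓝[≠] (0 : ℂ), z ∈ ((L.lattice : Set ℂ) ∪ L'.lattice)ᶜ ∧
      L.weierstrassP =ᶠ[𝓝 z] L'.weierstrassP := by
    filter_upwards [nhdsWithin_le_nhds heq.eventually_nhds, self_mem_nhdsWithin,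
      nhdsWithin_le_nhds (L.compl_lattice_sdiff_singleton_mem_nhds 0),
      nhdsWithin_le_nhds (L'.compl_lattice_sdiff_singleton_mem_nhds 0)] with z hz hz0 hzL hzL'
    refine ⟨fun h => h.elim (fun h => hzL ⟨h, hz0⟩) (fun h => hzL' ⟨h, hz0⟩), ?_⟩
    filter_upwards [hz] with w hw
    rw [← L.weierstrassPExcept_add 0 w, ← L'.weierstrassPExcept_add 0 w, ZeroMemClass.coe_zero,
      ZeroMemClass.coe_zero, hw]
  obtain ⟨z₀, hz₀, hz₀'⟩ := hnear.exists
  have hL := L.analyticOnNhd_weierstrassP.mono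
    (Set.compl_subset_compl.2 (Set.subset_union_left (t := (L'.lattice : Set ℂ))))
  have hL' := L'.analyticOnNhd_weierstrassP.mono
    (Set.compl_subset_compl.2 (Set.subset_union_right (s := (L.lattice : Set ℂ))))
  exact hL.eqOn_of_preconnected_of_eventuallyEq hL' hconn hz₀ hz₀'

lemma lattice_le_of_eqOn_weierstrassP {L L' : PeriodPair}
    (heq : Set.EqOn L.weierstrassP L'.weierstrassP ((L.lattice : Set ℂ) ∪ L'.lattice)ᶜ) :
    L.lattice ≤ L'.lattice := by
  intro l hl
  by_contra hl'
  have hev : L.weierstrassP =ᶠ[𝓝[≠] l] L'.weierstrassP := by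
    filter_upwards [self_mem_nhdsWithin,
      nhdsWithin_le_nhds (L.compl_lattice_sdiff_singleton_mem_nhds l),
      nhdsWithin_le_nhds (L'.isClosed_lattice.isOpen_compl.mem_nhds hl')] with z hz0 hzL hzL'
    exact heq fun h => h.elim (fun h => hzL ⟨h, hz0⟩) hzL'
  have hord := (L'.analyticOnNhd_weierstrassP l hl').meromorphicOrderAt_nonneg
  rw [← meromorphicOrderAt_congr hev, L.order_weierstrassP l hl] at hord
  exact absurd hord (by decide)

lemma lattice_eq_of_invariants_eq {L L' : PeriodPair} (h2 : L.g₂ = L'.g₂) (h3 : L.g₃ = L'.g₃) :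
    L.lattice = L'.lattice :=
  le_antisymm (lattice_le_of_eqOn_weierstrassP (eqOn_weierstrassP_of_invariants_eq h2 h3))
    (lattice_le_of_eqOn_weierstrassP (eqOn_weierstrassP_of_invariants_eq h2.symm h3.symm))

lemma exists_pow_four_pow_six_scaling {F : Type*} [Field F] [IsAlgClosed F] {a b a' b' : F}
    (h : a ≠ 0 ∨ b ≠ 0) (h' : a' ≠ 0 ∨ b' ≠ 0) (key : a ^ 3 * b' ^ 2 = a' ^ 3 * b ^ 2) :
    ∃ z ≠ 0, a = z ^ 4 * a' ∧ b = z ^ 6 * b' := by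
  by_cases ha : a = 0
  · have hb : b ≠ 0 := h.resolve_left (not_not.2 ha)
    have ha' : a' = 0 := by simpa [ha, hb] using key
    have hb' : b' ≠ 0 := h'.resolve_left (not_not.2 ha')
    obtain ⟨z, hz⟩ := IsAlgClosed.exists_pow_nat_eq (b / b') (n := 6) (by norm_num)
    exact ⟨z, ne_zero_pow (by norm_num) (hz ▸ div_ne_zero hb hb'), by simp [ha, ha'],
      by rw [hz, div_mul_cancel₀ _ hb']⟩
  have ha' : a' ≠ 0 := by
    rintro rfl
    have hb' : b' ≠ 0 := h'.resolve_left (not_not.2 rfl)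
    simp [ha, hb'] at key
  by_cases hb : b = 0
  · have hb' : b' = 0 := by simpa [hb, ha] using key
    obtain ⟨z, hz⟩ := IsAlgClosed.exists_pow_nat_eq (a / a') (n := 4) (by norm_num)
    exact ⟨z, ne_zero_pow (by norm_num) (hz ▸ div_ne_zero ha ha'),
      by rw [hz, div_mul_cancel₀ _ ha'], by simp [hb, hb']⟩
  have hb' : b' ≠ 0 := by
    rintro rfl
    simp [ha', hb] at key
  obtain ⟨z, hz⟩ := IsAlgClosed.exists_pow_nat_eq (b * a' / (b' * a)) (n := 2) (by norm_num)
  have h4 : z ^ 4 = a / a' := by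
    rw [show z ^ 4 = (z ^ 2) ^ 2 by ring, hz]
    field_simp
    linear_combination -key
  refine ⟨z, ?_, by rw [h4, div_mul_cancel₀ _ ha'], ?_⟩
  · exact ne_zero_pow two_ne_zero (hz ▸ div_ne_zero (mul_ne_zero hb ha') (mul_ne_zero hb' ha))
  · rw [show z ^ 6 = z ^ 2 * z ^ 4 by ring, hz, h4]
    field_simp

lemma latticeG2_ne_zero_or_latticeG3_ne_zero (τ : ℍ) :
    latticeG2 (upperLattice τ) ≠ 0 ∨ latticeG3 (upperLattice τ) ≠ 0 := by
  by_contra! h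
  exact latticeDisc_upperLattice_ne_zero τ (by simp [latticeDisc, h.1, h.2])

/-- The periods `z τ, z`. -/
def scaledPeriodPair (τ : ℍ) (z : ℂ) (hz : z ≠ 0) : PeriodPair where
  ω₁ := z * τ
  ω₂ := z
  indep := by
    refine LinearIndependent.pair_iff.2 fun s t h =>
      LinearIndependent.pair_iff.1 (linearIndependent_pair_of_im_ne_zero τ.im_ne_zero) s t
        (mul_left_cancel₀ hz ?_)
    simp only [real_smul] at h ⊢
    linear_combination h

lemma mem_lattice_scaledPeriodPair {τ : ℍ} {z : ℂ} (hz : z ≠ 0) (w : ℂ) :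
    w ∈ (scaledPeriodPair τ z hz).lattice ↔ ∃ v ∈ upperLattice τ, w = z * v := by
  rw [PeriodPair.mem_lattice]
  constructor
  · rintro ⟨m, n, rfl⟩
    exact ⟨m * τ + n, mem_upperLattice.2 ⟨m, n, rfl⟩, by simp only [scaledPeriodPair]; ring⟩
  · rintro ⟨v, hv, rfl⟩
    obtain ⟨m, n, rfl⟩ := mem_upperLattice.1 hv
    exact ⟨m, n, by simp only [scaledPeriodPair]; ring⟩

/-- Homothety of lattices: `Λ' = z Λ` for some `z ≠ 0`, with the equality spelled out elementwise
as in `latticeG_smul`. -/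
def IsHomothetic (Λ Λ' : Submodule ℤ ℂ) : Prop :=
  ∃ z : ℂ, z ≠ 0 ∧ ∀ w, w ∈ Λ' ↔ ∃ v ∈ Λ, w = z * v

lemma isHomothetic_of_modularJ_eq {τ τ' : ℍ} (h : modularJ τ = modularJ τ') :
    IsHomothetic (upperLattice τ) (upperLattice τ') := by
  have key : latticeG2 (upperLattice τ) ^ 3 * latticeG3 (upperLattice τ') ^ 2
      = latticeG2 (upperLattice τ') ^ 3 * latticeG3 (upperLattice τ) ^ 2 := by
    change latticeJ (upperLattice τ) = latticeJ (upperLattice τ') at h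
    rw [latticeJ, latticeJ, div_eq_div_iff (latticeDisc_upperLattice_ne_zero τ)
      (latticeDisc_upperLattice_ne_zero τ'), latticeDisc, latticeDisc] at h
    linear_combination (-1 / (27 * (2 ^ 6 * 3 ^ 3))) * h
  obtain ⟨z, hz, h2, h3⟩ := exists_pow_four_pow_six_scaling
    (latticeG2_ne_zero_or_latticeG3_ne_zero τ) (latticeG2_ne_zero_or_latticeG3_ne_zero τ') key
  have hG := latticeG_smul _ _ z hz (mem_lattice_scaledPeriodPair (τ := τ) hz)
  have e2 : (scaledPeriodPair τ z hz).g₂ = (upperPeriodPair τ').g₂ := by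
    change 60 * latticeG (scaledPeriodPair τ z hz).lattice 4 = latticeG2 (upperLattice τ')
    rw [hG, mul_left_comm]
    exact (inv_mul_eq_iff_eq_mul₀ (pow_ne_zero 4 hz)).2 h2
  have e3 : (scaledPeriodPair τ z hz).g₃ = (upperPeriodPair τ').g₃ := by
    change 140 * latticeG (scaledPeriodPair τ z hz).lattice 6 = latticeG3 (upperLattice τ')
    rw [hG, mul_left_comm]
    exact (inv_mul_eq_iff_eq_mul₀ (pow_ne_zero 6 hz)).2 h3
  refine ⟨z, hz, fun w => ?_⟩
  rw [← mem_lattice_scaledPeriodPair hz, lattice_eq_of_invariants_eq e2 e3]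
  rfl

/-! ### Sublattices and integral matrices -/

/-- The vector `M (τ, 1)ᵗ`. For `det M ≠ 0` its entries form a basis of a sublattice of
`ℤ τ + ℤ` of index `|det M|`. -/
def periods (M : Matrix (Fin 2) (Fin 2) ℤ) (τ : ℍ) : Fin 2 → ℂ :=
  (M.map (Int.castRingHom ℂ)).mulVec ![(τ : ℂ), 1]

lemma periods_apply (M : Matrix (Fin 2) (Fin 2) ℤ) (τ : ℍ) (i : Fin 2) :
    periods M τ i = M i 0 * τ + M i 1 := by
  simp [periods, Matrix.mulVec, dotProduct, Fin.sum_univ_two]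

lemma periods_eq_smul_iff {M : Matrix (Fin 2) (Fin 2) ℤ} {τ : ℍ} {x : ℂ} :
    periods M τ = x • ![(τ : ℂ), 1] ↔
      (M 0 0 * τ + M 0 1 : ℂ) = x * τ ∧ (M 1 0 * τ + M 1 1 : ℂ) = x := by
  simp [funext_iff, Fin.forall_fin_two, periods_apply]

lemma periods_one (τ : ℍ) : periods 1 τ = ![(τ : ℂ), 1] := by
  simp [periods]

lemma periods_mul (N M : Matrix (Fin 2) (Fin 2) ℤ) (τ : ℍ) :
    periods (N * M) τ = (N.map (Int.castRingHom ℂ)).mulVec (periods M τ) := by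
  rw [periods, periods, Matrix.map_mul, Matrix.mulVec_mulVec]

lemma periods_zsmul (s : ℤ) (M : Matrix (Fin 2) (Fin 2) ℤ) (τ : ℍ) :
    periods (s • M) τ = (s : ℂ) • periods M τ := by
  ext i
  simp only [periods_apply, Matrix.smul_apply, smul_eq_mul, Pi.smul_apply]
  push_cast
  ring

lemma periods_injective (τ : ℍ) : Function.Injective (periods · τ) := by
  intro M N h
  ext i j
  have hi : (M i 0 * τ + M i 1 : ℂ) = N i 0 * τ + N i 1 := by
    simpa only [periods_apply] using congrFun h i
  obtain ⟨h0, h1⟩ := LinearIndependent.pair_iff.1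
    (linearIndependent_pair_of_im_ne_zero τ.im_ne_zero) (M i 0 - N i 0) (M i 1 - N i 1) (by
      simp only [real_smul]
      push_cast
      linear_combination hi)
  fin_cases j
  · exact_mod_cast sub_eq_zero.1 h0
  · exact_mod_cast sub_eq_zero.1 h1

lemma periods_smul (γ : SL(2, ℤ)) (M : Matrix (Fin 2) (Fin 2) ℤ) (τ : ℍ) :
    periods M (γ • τ) = (denom γ τ)⁻¹ • periods (M * γ.1) τ := by
  have hγ : periods γ.1 τ = denom γ τ • ![((γ • τ : ℍ) : ℂ), 1] := by
    have h : ((γ • τ : ℍ) : ℂ) = periods γ.1 τ 0 / denom γ τ := by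
      rw [specialLinearGroup_apply]
      simp [periods_apply, denom]
    ext i
    fin_cases i
    · simp only [Fin.zero_eta, Pi.smul_apply, Matrix.cons_val_zero, smul_eq_mul, h,
        mul_div_cancel₀ _ (denom_ne_zero γ τ)]
    · simp [periods_apply, denom]
  rw [periods_mul, hγ, Matrix.mulVec_smul, inv_smul_smul₀ (denom_ne_zero γ τ), periods]

/-- The sublattice of `ℤ τ + ℤ` generated by the entries of `M (τ, 1)ᵗ`. -/
def matrixLattice (M : Matrix (Fin 2) (Fin 2) ℤ) (τ : ℍ) : Submodule ℤ ℂ :=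
  Submodule.span ℤ (Set.range (periods M τ))

lemma matrixLattice_one (τ : ℍ) : matrixLattice 1 τ = upperLattice τ := by
  rw [matrixLattice, periods_one, upperLattice]
  simp [Matrix.range_cons, Set.pair_comm]

lemma matrixLattice_le_iff {A M : Matrix (Fin 2) (Fin 2) ℤ} {τ : ℍ} :
    matrixLattice A τ ≤ matrixLattice M τ ↔ ∃ N, A = N * M := by
  rw [matrixLattice, Submodule.span_le, Set.range_subset_iff]
  simp only [matrixLattice, SetLike.mem_coe, Submodule.mem_span_range_iff_exists_fun]
  constructor
  · intro h
    choose N hN using h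
    refine ⟨Matrix.of N, periods_injective τ ?_⟩
    change periods A τ = periods (Matrix.of N * M) τ
    rw [periods_mul]
    ext i
    simp [← hN, Matrix.mulVec, dotProduct]
  · rintro ⟨N, rfl⟩ i
    exact ⟨N i, by simp [periods_mul, Matrix.mulVec, dotProduct]⟩

lemma exists_eq_mul_of_matrixLattice_eq {A M : Matrix (Fin 2) (Fin 2) ℤ} {τ : ℍ}
    (hA : 0 < A.det) (hM : 0 < M.det) (h : matrixLattice A τ = matrixLattice M τ) :
    ∃ δ : SL(2, ℤ), A = δ.1 * M := by
  obtain ⟨N, hN⟩ := matrixLattice_le_iff.1 h.le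
  obtain ⟨N', hN'⟩ := matrixLattice_le_iff.1 h.ge
  have hdet : N'.det * N.det = 1 := by
    refine mul_right_cancel₀ hM.ne' ?_
    rw [one_mul, mul_assoc, ← Matrix.det_mul N M, ← hN, ← Matrix.det_mul, ← hN']
  have hpos : 0 < N.det := by
    rw [hN, Matrix.det_mul] at hA
    exact pos_of_mul_pos_left hA hM.le
  exact ⟨⟨N, Int.eq_one_of_dvd_one hpos.le ⟨_, (mul_comm _ _).trans hdet |>.symm⟩⟩, hN⟩

lemma matrixLattice_mul_left (δ : SL(2, ℤ)) (M : Matrix (Fin 2) (Fin 2) ℤ) (τ : ℍ) :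
    matrixLattice (δ.1 * M) τ = matrixLattice M τ := by
  refine le_antisymm (matrixLattice_le_iff.2 ⟨_, rfl⟩) (matrixLattice_le_iff.2 ⟨(δ⁻¹).1, ?_⟩)
  rw [← mul_assoc, ← Matrix.SpecialLinearGroup.coe_mul, inv_mul_cancel,
    Matrix.SpecialLinearGroup.coe_one, one_mul]

lemma mem_span_range_smul {ι : Type*} (c : ℂ) (v : ι → ℂ) (w : ℂ) :
    w ∈ Submodule.span ℤ (Set.range (c • v)) ↔
      ∃ u ∈ Submodule.span ℤ (Set.range v), w = c * u := by
  have hrange : Set.range (c • v) = LinearMap.mulLeft ℤ c '' Set.range v := by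
    rw [← Set.range_comp]
    rfl
  rw [hrange, ← Submodule.map_span]
  simp [eq_comm]

lemma latticeJ_span_range_smul {ι : Type*} {c : ℂ} (hc : c ≠ 0) (v : ι → ℂ) :
    latticeJ (Submodule.span ℤ (Set.range (c • v))) = latticeJ (Submodule.span ℤ (Set.range v)) :=
  latticeJ_smul _ _ c hc (mem_span_range_smul c v)

/-- The invariant of the lattice generated by the entries of `M (τ, 1)ᵗ`. -/
def matrixJ (M : Matrix (Fin 2) (Fin 2) ℤ) (τ : ℍ) : ℂ := latticeJ (matrixLattice M τ)

lemma matrixJ_mul_left (δ : SL(2, ℤ)) (M : Matrix (Fin 2) (Fin 2) ℤ) (τ : ℍ) :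
    matrixJ (δ.1 * M) τ = matrixJ M τ := by
  rw [matrixJ, matrixLattice_mul_left, matrixJ]

lemma matrixJ_smul (γ : SL(2, ℤ)) (M : Matrix (Fin 2) (Fin 2) ℤ) (τ : ℍ) :
    matrixJ M (γ • τ) = matrixJ (M * γ.1) τ := by
  rw [matrixJ, matrixLattice, periods_smul,
    latticeJ_span_range_smul (inv_ne_zero (denom_ne_zero γ τ)), matrixJ, matrixLattice]

lemma matrixJ_eq_modularJ {M : Matrix (Fin 2) (Fin 2) ℤ} {τ τ' : ℍ} {c : ℂ} (hc : c ≠ 0)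
    (h : periods M τ = c • ![(τ' : ℂ), 1]) : matrixJ M τ = modularJ τ' := by
  rw [matrixJ, matrixLattice, h, latticeJ_span_range_smul hc, ← periods_one, ← matrixLattice,
    matrixLattice_one, upperLattice, modularJ]

/-! ### Multipliers -/

/-- The complex numbers `x` with `x Λ ⊆ Λ`. -/
def multipliers (Λ : Submodule ℤ ℂ) : Set ℂ := {x | ∀ v ∈ Λ, x * v ∈ Λ}

lemma matrixLattice_le_upperLattice (M : Matrix (Fin 2) (Fin 2) ℤ) (τ : ℍ) :
    matrixLattice M τ ≤ upperLattice τ := by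
  rw [← matrixLattice_one]
  exact matrixLattice_le_iff.2 ⟨M, (mul_one M).symm⟩

lemma mem_matrixLattice_iff_of_periods_eq {τ : ℍ} {x : ℂ} {M : Matrix (Fin 2) (Fin 2) ℤ}
    (h : periods M τ = x • ![(τ : ℂ), 1]) (w : ℂ) :
    w ∈ matrixLattice M τ ↔ ∃ v ∈ upperLattice τ, w = x * v := by
  rw [matrixLattice, h, mem_span_range_smul, ← periods_one, ← matrixLattice, matrixLattice_one]

lemma mem_multipliers_upperLattice {τ : ℍ} {x : ℂ} : x ∈ multipliers (upperLattice τ) ↔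
    ∃ M, periods M τ = x • ![(τ : ℂ), 1] := by
  constructor
  · intro h
    obtain ⟨a, b, hab⟩ := mem_upperLattice.1 (h τ (Submodule.subset_span (by simp)))
    obtain ⟨c, d, hcd⟩ := mem_upperLattice.1 (h 1 (Submodule.subset_span (by simp)))
    refine ⟨!![a, b; c, d], ?_⟩
    ext i
    fin_cases i <;> simp [periods_apply, ← hab, ← hcd]
  · rintro ⟨M, hM⟩ v hv
    exact matrixLattice_le_upperLattice M τ
      ((mem_matrixLattice_iff_of_periods_eq hM _).2 ⟨v, hv, rfl⟩)

open scoped ComplexConjugate in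
lemma det_eq_normSq {τ : ℍ} {x : ℂ} {M : Matrix (Fin 2) (Fin 2) ℤ}
    (h : periods M τ = x • ![(τ : ℂ), 1]) : (M.det : ℝ) = Complex.normSq x := by
  obtain ⟨h0, h1⟩ := periods_eq_smul_iff.1 h
  have h0' : (M 0 0 * conj (τ : ℂ) + M 0 1 : ℂ) = conj x * conj (τ : ℂ) := by
    simpa using congrArg conj h0
  have h1' : (M 1 0 * conj (τ : ℂ) + M 1 1 : ℂ) = conj x := by simpa using congrArg conj h1
  have hτ : (τ : ℂ) - conj (τ : ℂ) ≠ 0 := by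
    rw [sub_conj]
    simp [τ.im_ne_zero]
  have hdet : (M.det : ℂ) = (Complex.normSq x : ℂ) := by
    refine mul_right_cancel₀ hτ ?_
    rw [Matrix.det_fin_two, ← mul_conj]
    push_cast
    linear_combination (M 1 0 * conj (τ : ℂ) + M 1 1 : ℂ) * h0 + x * τ * h1'
      - (M 0 0 * conj (τ : ℂ) + M 0 1 : ℂ) * h1 - x * h0'
  exact ofReal_injective (by rwa [ofReal_intCast])

/-- The norms of the elements of `O` that are not the product of an integer and an element of
norm `1`. -/
def normSet (O : Set ℂ) : Set ℕ :=
  {m | ∃ x ∈ O, Complex.normSq x = m ∧ ∀ s : ℤ, ∀ u ∈ O, Complex.normSq u = 1 → x ≠ s * u}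

/-! ### Hermite normal forms -/

open FixedDetMatrices in
lemma exists_reduce_eq_smul {m : ℤ} (A : FixedDetMatrix (Fin 2) ℤ m) :
    ∃ δ : SL(2, ℤ), reduce A = δ • A := by
  induction A using reduce_rec with
  | base A h =>
    by_cases ha : 0 < A.1 0 0
    · exact ⟨_, reduce_of_pos h ha⟩
    · exact ⟨_, by rw [reduce_of_not_pos h ha, ← mul_smul, ← mul_smul]⟩
  | step A h ih =>
    obtain ⟨δ, hδ⟩ := ih
    rw [reduce_reduceStep h] at hδ
    exact ⟨_, by rw [hδ, reduceStep, ← mul_smul, ← mul_smul]⟩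

lemma exists_hermite_normal_form {M : Matrix (Fin 2) (Fin 2) ℤ} (hM : 0 < M.det) :
    ∃ (δ : SL(2, ℤ)) (a b d : ℕ), b < d ∧ δ.1 * M = !![(a : ℤ), b; 0, d] := by
  obtain ⟨δ, hδ⟩ := exists_reduce_eq_smul (⟨M, rfl⟩ : FixedDetMatrix (Fin 2) ℤ M.det)
  obtain ⟨h10, h00, h01, h11⟩ := FixedDetMatrices.reduce_mem_reps hM.ne' ⟨M, rfl⟩
  set A := FixedDetMatrices.reduce (⟨M, rfl⟩ : FixedDetMatrix (Fin 2) ℤ M.det)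
  have hd : 0 < A.1 1 1 := by
    have hdet : A.1.det = M.det := A.2
    rw [Matrix.det_fin_two, h10, mul_zero, sub_zero] at hdet
    exact (mul_pos_iff_of_pos_left h00).1 (by rwa [hdet])
  rw [abs_of_nonneg h01, abs_of_pos hd] at h11
  refine ⟨δ, (A.1 0 0).toNat, (A.1 0 1).toNat, (A.1 1 1).toNat,
    (Int.toNat_lt_toNat hd).2 h11, ?_⟩
  rw [Int.toNat_of_nonneg h00.le, Int.toNat_of_nonneg h01, Int.toNat_of_nonneg hd.le, ← h10,
    ← Matrix.eta_fin_two, hδ]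
  rfl

lemma exists_eq_unipotent_of_mul_upper_eq_upper {a b d a' b' d' : ℤ} (ha : 0 < a) (ha' : 0 < a')
    {δ : SL(2, ℤ)} (h : δ.1 * !![a, b; 0, d] = !![a', b'; 0, d']) :
    ∃ q : ℤ, δ.1 = !![1, q; 0, 1] := by
  have e00 : δ.1 0 0 * a = a' := by simpa [Matrix.mul_apply] using congrFun (congrFun h 0) 0
  have e10 : δ.1 1 0 = 0 := by
    simpa [Matrix.mul_apply, ha.ne'] using congrFun (congrFun h 1) 0
  have hdet : δ.1 0 0 * δ.1 1 1 = 1 := by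
    have := δ.2
    rwa [Matrix.det_fin_two, e10, mul_zero, sub_zero] at this
  have hpos : 0 < δ.1 0 0 := pos_of_mul_pos_left (e00 ▸ ha') ha.le
  have h00 : δ.1 0 0 = 1 := Int.eq_one_of_dvd_one hpos.le ⟨_, hdet.symm⟩
  have h11 : δ.1 1 1 = 1 := by rwa [h00, one_mul] at hdet
  exact ⟨δ.1 0 1, (Matrix.eta_fin_two δ.1).trans (by rw [h00, e10, h11])⟩

lemma hermite_normal_form_unique {a b d a' b' d' : ℕ} (ha : 0 < a) (ha' : 0 < a') (hb : b < d)
    (hb' : b' < d') {δ : SL(2, ℤ)}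
    (h : δ.1 * !![(a : ℤ), b; 0, d] = !![(a' : ℤ), b'; 0, d']) :
    a = a' ∧ b = b' ∧ d = d' := by
  obtain ⟨q, hq⟩ := exists_eq_unipotent_of_mul_upper_eq_upper (by exact_mod_cast ha)
    (by exact_mod_cast ha') h
  rw [hq] at h
  have e00 : (a : ℤ) = a' := by simpa [Matrix.mul_apply] using congrFun (congrFun h 0) 0
  have e01 : (b + q * d : ℤ) = b' := by simpa [Matrix.mul_apply] using congrFun (congrFun h 0) 1
  have e11 : (d : ℤ) = d' := by simpa [Matrix.mul_apply] using congrFun (congrFun h 1) 1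
  have hq0 : q = 0 := by
    by_contra hq0
    rcases lt_or_gt_of_ne hq0 with hlt | hgt <;> nlinarith
  rw [hq0, zero_mul, add_zero] at e01
  exact ⟨by exact_mod_cast e00, by exact_mod_cast e01, by exact_mod_cast e11⟩

/-- The matrix is the product of an integer and an element of `SL(2, ℤ)`; it then takes every
lattice to a homothetic one. -/
def IsIntMulSL (M : Matrix (Fin 2) (Fin 2) ℤ) : Prop := ∃ (s : ℤ) (N : SL(2, ℤ)), M = s • N.1

lemma IsIntMulSL.mul_left {M : Matrix (Fin 2) (Fin 2) ℤ} (h : IsIntMulSL M) (δ : SL(2, ℤ)) :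
    IsIntMulSL (δ.1 * M) := by
  obtain ⟨s, N, rfl⟩ := h
  exact ⟨s, δ * N, by rw [Matrix.mul_smul, Matrix.SpecialLinearGroup.coe_mul]⟩

lemma IsIntMulSL.mul_right {M : Matrix (Fin 2) (Fin 2) ℤ} (h : IsIntMulSL M) (δ : SL(2, ℤ)) :
    IsIntMulSL (M * δ.1) := by
  obtain ⟨s, N, rfl⟩ := h
  exact ⟨s, N * δ, by rw [Matrix.smul_mul, Matrix.SpecialLinearGroup.coe_mul]⟩

lemma isIntMulSL_mul_left_iff {M : Matrix (Fin 2) (Fin 2) ℤ} (δ : SL(2, ℤ)) :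
    IsIntMulSL (δ.1 * M) ↔ IsIntMulSL M := by
  refine ⟨fun h => ?_, fun h => h.mul_left δ⟩
  simpa only [← mul_assoc, ← Matrix.SpecialLinearGroup.coe_mul, inv_mul_cancel,
    Matrix.SpecialLinearGroup.coe_one, one_mul] using h.mul_left δ⁻¹

lemma isIntMulSL_mul_right_iff {M : Matrix (Fin 2) (Fin 2) ℤ} (δ : SL(2, ℤ)) :
    IsIntMulSL (M * δ.1) ↔ IsIntMulSL M := by
  refine ⟨fun h => ?_, fun h => h.mul_right δ⟩
  simpa only [mul_assoc, ← Matrix.SpecialLinearGroup.coe_mul, mul_inv_cancel,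
    Matrix.SpecialLinearGroup.coe_one, mul_one] using h.mul_right δ⁻¹

/-- A matrix `!![a, b; 0, d]` in Hermite normal form with determinant `m`, not a scalar matrix.
These matrices represent the sublattices of index `m` of a lattice `Λ` that are not of the form
`s Λ`. -/
@[ext]
structure HeckeTriple (m : ℕ) where
  /-- the upper left entry -/
  a : ℕ
  /-- the upper right entry -/
  b : ℕ
  /-- the lower right entry -/
  d : ℕ
  mul_eq : a * d = m
  b_lt : b < d
  not_scalar : ¬ (a = d ∧ b = 0)

namespace HeckeTriple

variable {m : ℕ}

/-- The matrix of a triple. -/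
def mat (t : HeckeTriple m) : Matrix (Fin 2) (Fin 2) ℤ := !![(t.a : ℤ), t.b; 0, t.d]

lemma det_mat (t : HeckeTriple m) : t.mat.det = m := by
  rw [mat, Matrix.det_fin_two_of, mul_zero, sub_zero]
  exact_mod_cast t.mul_eq

lemma d_pos (t : HeckeTriple m) : 0 < t.d := (Nat.zero_le _).trans_lt t.b_lt

variable [NeZero m]

lemma a_pos (t : HeckeTriple m) : 0 < t.a :=
  Nat.pos_of_ne_zero fun h => NeZero.ne m (by rw [← t.mul_eq, h, zero_mul])

lemma a_le (t : HeckeTriple m) : t.a ≤ m := Nat.le_of_dvd (NeZero.pos m) ⟨t.d, t.mul_eq.symm⟩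

lemma d_le (t : HeckeTriple m) : t.d ≤ m :=
  Nat.le_of_dvd (NeZero.pos m) ⟨t.a, by rw [mul_comm, t.mul_eq]⟩

instance : Finite (HeckeTriple m) := by
  refine Finite.of_injective (β := Fin (m + 1) × Fin (m + 1) × Fin (m + 1))
    (fun t => (⟨t.a, Nat.lt_succ_of_le t.a_le⟩,
      ⟨t.b, Nat.lt_succ_of_le (t.b_lt.le.trans t.d_le)⟩,
      ⟨t.d, Nat.lt_succ_of_le t.d_le⟩)) fun t t' h => ?_
  simp only [Prod.mk.injEq, Fin.mk.injEq] at h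
  exact HeckeTriple.ext h.1 h.2.1 h.2.2

instance : Fintype (HeckeTriple m) := Fintype.ofFinite _

lemma eq_of_mul_mat_eq {t t' : HeckeTriple m} {δ : SL(2, ℤ)} (h : δ.1 * t.mat = t'.mat) :
    t = t' := by
  obtain ⟨ha, hb, hd⟩ := hermite_normal_form_unique t.a_pos t'.a_pos t.b_lt t'.b_lt h
  exact HeckeTriple.ext ha hb hd

lemma not_isIntMulSL_mat (t : HeckeTriple m) : ¬ IsIntMulSL t.mat := by
  suffices key : ∀ (s : ℕ) (N : SL(2, ℤ)), t.mat ≠ (s : ℤ) • N.1 by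
    rintro ⟨s, N, h⟩
    rcases Int.eq_nat_or_neg s with ⟨n, rfl | rfl⟩
    · exact key n N h
    · exact key n (-N) (by simp [h])
  intro s N h
  have hs : 0 < s := by
    refine Nat.pos_of_ne_zero fun hs => NeZero.ne m ?_
    have hdet := t.det_mat
    rw [h, hs, Nat.cast_zero, zero_smul, Matrix.det_zero] at hdet
    exact_mod_cast hdet.symm
  have hN : (N⁻¹).1 * t.mat = !![(s : ℤ), (0 : ℕ); 0, s] := by
    rw [h, Matrix.mul_smul, ← Matrix.SpecialLinearGroup.coe_mul, inv_mul_cancel,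
      Matrix.SpecialLinearGroup.coe_one]
    ext i j
    fin_cases i <;> fin_cases j <;> simp
  obtain ⟨ha, hb, hd⟩ := hermite_normal_form_unique t.a_pos hs t.b_lt hs hN
  exact t.not_scalar ⟨ha.trans hd.symm, hb⟩

end HeckeTriple

lemma exists_heckeTriple {m : ℕ} [NeZero m] {M : Matrix (Fin 2) (Fin 2) ℤ} (hM : M.det = m)
    (hM' : ¬ IsIntMulSL M) : ∃ (t : HeckeTriple m) (δ : SL(2, ℤ)), δ.1 * M = t.mat := by
  obtain ⟨δ, a, b, d, hbd, h⟩ := exists_hermite_normal_form (M := M)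
    (by rw [hM]; exact_mod_cast NeZero.pos m)
  have had : a * d = m := by
    have hdet := congrArg Matrix.det h
    rw [Matrix.det_mul, δ.2, one_mul, hM, Matrix.det_fin_two_of, mul_zero, sub_zero] at hdet
    exact_mod_cast hdet.symm
  refine ⟨⟨a, b, d, had, hbd, ?_⟩, δ, h⟩
  rintro ⟨rfl, rfl⟩
  refine hM' ((isIntMulSL_mul_left_iff δ).1 ⟨a, 1, ?_⟩)
  rw [h, Matrix.SpecialLinearGroup.coe_one]
  ext i j
  fin_cases i <;> fin_cases j <;> simp

/-! ### The Hecke product -/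

/-- The product of the differences `j(Λ) - j(Λ')`, over the sublattices `Λ'` of index `m` in
`Λ = ℤ τ + ℤ` that are not of the form `s Λ`. -/
def heckeProduct (m : ℕ) [NeZero m] (τ : ℍ) : ℂ :=
  ∏ t : HeckeTriple m, (modularJ τ - matrixJ t.mat τ)

lemma heckeProduct_smul {m : ℕ} [NeZero m] (γ : SL(2, ℤ)) (τ : ℍ) :
    heckeProduct m (γ • τ) = heckeProduct m τ := by
  have key (t : HeckeTriple m) :
      ∃ (t' : HeckeTriple m) (δ : SL(2, ℤ)), δ.1 * (t.mat * γ.1) = t'.mat :=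
    exists_heckeTriple (by rw [Matrix.det_mul, γ.2, mul_one, t.det_mat])
      ((isIntMulSL_mul_right_iff γ).not.2 t.not_isIntMulSL_mat)
  choose e δ he using key
  have hinj : Function.Injective e := by
    intro t t' htt'
    refine HeckeTriple.eq_of_mul_mat_eq (δ := (δ t')⁻¹ * δ t) ?_
    have h : (δ t).1 * t.mat * γ.1 = (δ t').1 * t'.mat * γ.1 := by
      rw [mul_assoc, he, htt', ← he, mul_assoc]
    have h' := congrArg (fun X => ((δ t')⁻¹).1 * (X * (γ⁻¹).1)) h
    simpa only [mul_assoc, ← Matrix.SpecialLinearGroup.coe_mul, mul_inv_cancel, mul_one,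
      Matrix.SpecialLinearGroup.coe_one, ← mul_assoc (_⁻¹ : SL(2, ℤ)).1, inv_mul_cancel,
      one_mul] using h'
  refine Fintype.prod_bijective e (Finite.injective_iff_bijective.1 hinj) _ _ fun t => ?_
  rw [modularJ_smul, matrixJ_smul, ← he, matrixJ_mul_left]

/-- The point `(a τ + b) / d`. -/
def HeckeTriple.point {m : ℕ} [NeZero m] (t : HeckeTriple m) (τ : ℍ) : ℍ :=
  ⟨(t.a * τ + t.b) / t.d, by
    have h1 : (0 : ℝ) < t.a := by exact_mod_cast t.a_pos
    have h2 : (0 : ℝ) < t.d := by exact_mod_cast t.d_pos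
    have := τ.im_pos
    simp only [Complex.div_natCast_im, Complex.add_im, Complex.mul_im, Complex.natCast_re,
      Complex.natCast_im, zero_mul, add_zero, coe_im]
    positivity⟩

lemma HeckeTriple.periods_mat {m : ℕ} [NeZero m] (t : HeckeTriple m) (τ : ℍ) :
    periods t.mat τ = (t.d : ℂ) • ![(t.point τ : ℂ), 1] := by
  have hd : (t.d : ℂ) ≠ 0 := by exact_mod_cast t.d_pos.ne'
  ext i
  fin_cases i
  · simp [periods_apply, mat, point, mul_div_cancel₀ _ hd]
  · simp [periods_apply, mat]

lemma HeckeTriple.matrixJ_eq {m : ℕ} [NeZero m] (t : HeckeTriple m) (τ : ℍ) :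
    matrixJ t.mat τ = modularJ (t.point τ) :=
  matrixJ_eq_modularJ (by exact_mod_cast t.d_pos.ne') (t.periods_mat τ)

lemma exists_periods_mul_mat_eq_smul {m : ℕ} [NeZero m] {t : HeckeTriple m} {τ : ℍ}
    (h : modularJ τ = matrixJ t.mat τ) :
    ∃ (x : ℂ) (δ : SL(2, ℤ)), periods (δ.1 * t.mat) τ = x • ![(τ : ℂ), 1] := by
  rw [t.matrixJ_eq] at h
  obtain ⟨z, hz, hzm⟩ := isHomothetic_of_modularJ_eq h
  have hd : (t.d : ℂ) ≠ 0 := by exact_mod_cast t.d_pos.ne'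
  have hmem (w : ℂ) : w ∈ matrixLattice t.mat τ ↔ ∃ v ∈ upperLattice τ, w = t.d * z * v := by
    rw [matrixLattice, t.periods_mat, mem_span_range_smul, ← periods_one, ← matrixLattice,
      matrixLattice_one]
    simp only [hzm, mul_assoc]
    grind
  obtain ⟨M, hM⟩ := mem_multipliers_upperLattice.1 fun v hv =>
    matrixLattice_le_upperLattice t.mat τ ((hmem (t.d * z * v)).2 ⟨v, hv, rfl⟩)
  have hdet : 0 < M.det := by
    have hpos := Complex.normSq_pos.2 (mul_ne_zero hd hz)
    rw [← det_eq_normSq hM] at hpos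
    exact_mod_cast hpos
  have hlat : matrixLattice M τ = matrixLattice t.mat τ :=
    SetLike.ext fun w => (mem_matrixLattice_iff_of_periods_eq hM w).trans (hmem w).symm
  obtain ⟨δ, hδ⟩ := exists_eq_mul_of_matrixLattice_eq hdet
    (by rw [t.det_mat]; exact_mod_cast NeZero.pos m) hlat
  exact ⟨_, δ, hδ ▸ hM⟩

lemma isIntMulSL_iff_of_periods_eq {τ : ℍ} {x : ℂ} {M : Matrix (Fin 2) (Fin 2) ℤ}
    (hM : periods M τ = x • ![(τ : ℂ), 1]) (hx : x ≠ 0) : IsIntMulSL M ↔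
      ∃ s : ℤ, ∃ u ∈ multipliers (upperLattice τ), Complex.normSq u = 1 ∧ x = s * u := by
  constructor
  · rintro ⟨s, N, rfl⟩
    rw [periods_zsmul] at hM
    have hs : (s : ℂ) ≠ 0 := by
      intro hs
      have h1 := congrFun hM 1
      rw [hs, zero_smul] at h1
      simp [hx.symm] at h1
    have hN : periods N.1 τ = ((s : ℂ)⁻¹ * x) • ![(τ : ℂ), 1] := by
      rw [mul_smul, ← hM, inv_smul_smul₀ hs]
    refine ⟨s, _, mem_multipliers_upperLattice.2 ⟨_, hN⟩, ?_, (mul_inv_cancel_left₀ hs x).symm⟩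
    rw [← det_eq_normSq hN, N.2, Int.cast_one]
  · rintro ⟨s, u, hu, hu1, rfl⟩
    obtain ⟨N, hN⟩ := mem_multipliers_upperLattice.1 hu
    have hdet : N.det = 1 := by
      have h := det_eq_normSq hN
      rw [hu1] at h
      exact_mod_cast h
    refine ⟨s, ⟨N, hdet⟩, periods_injective τ ?_⟩
    change periods M τ = periods (s • N) τ
    rw [hM, periods_zsmul, hN, mul_smul]

lemma mem_normSet_multipliers_iff {m : ℕ} [NeZero m] {τ : ℍ} :
    m ∈ normSet (multipliers (upperLattice τ)) ↔
      ∃ (x : ℂ) (M : Matrix (Fin 2) (Fin 2) ℤ),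
        periods M τ = x • ![(τ : ℂ), 1] ∧ M.det = m ∧ ¬ IsIntMulSL M := by
  have hx0 {x : ℂ} (h : Complex.normSq x = m) : x ≠ 0 := by
    rintro rfl
    rw [map_zero] at h
    exact NeZero.ne m (by exact_mod_cast h.symm)
  constructor
  · rintro ⟨x, hx, hxm, hxs⟩
    obtain ⟨M, hM⟩ := mem_multipliers_upperLattice.1 hx
    refine ⟨x, M, hM, by exact_mod_cast (det_eq_normSq hM).trans hxm, fun h => ?_⟩
    obtain ⟨s, u, hu, hu1, h⟩ := (isIntMulSL_iff_of_periods_eq hM (hx0 hxm)).1 h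
    exact hxs s u hu hu1 h
  · rintro ⟨x, M, hM, hdet, hM'⟩
    have hxm : Complex.normSq x = m := by
      rw [← det_eq_normSq hM, hdet, Int.cast_natCast]
    exact ⟨x, mem_multipliers_upperLattice.2 ⟨M, hM⟩, hxm, fun s u hu hu1 h =>
      hM' ((isIntMulSL_iff_of_periods_eq hM (hx0 hxm)).2 ⟨s, u, hu, hu1, h⟩)⟩

lemma heckeProduct_eq_zero_iff {m : ℕ} [NeZero m] (τ : ℍ) :
    heckeProduct m τ = 0 ↔ m ∈ normSet (multipliers (upperLattice τ)) := by
  rw [heckeProduct, Finset.prod_eq_zero_iff, mem_normSet_multipliers_iff]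
  constructor
  · rintro ⟨t, -, ht⟩
    obtain ⟨x, δ, hx⟩ := exists_periods_mul_mat_eq_smul (sub_eq_zero.1 ht)
    refine ⟨x, _, hx, ?_, (isIntMulSL_mul_left_iff δ).not.2 t.not_isIntMulSL_mat⟩
    rw [Matrix.det_mul, δ.2, one_mul, t.det_mat]
  · rintro ⟨x, M, hM, hdet, hM'⟩
    obtain ⟨t, δ, hδ⟩ := exists_heckeTriple hdet hM'
    have hx : x ≠ 0 := by
      rintro rfl
      have h := det_eq_normSq hM
      rw [hdet, map_zero] at h
      exact NeZero.ne m (by exact_mod_cast h)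
    refine ⟨t, Finset.mem_univ t, sub_eq_zero.2 ?_⟩
    rw [← hδ, matrixJ_mul_left, matrixJ_eq_modularJ hx hM]

/-! ### The modular equation -/

section PowerSeries

variable {A B : Type*} [CommRing A] [CommRing B]

/-- The series of the coefficients whose index is a multiple of `m`. -/
def decimate (m : ℕ) (P : PowerSeries A) : PowerSeries A := PowerSeries.mk fun n => P.coeff (m * n)

lemma map_decimate (f : A →+* B) (m : ℕ) (P : PowerSeries A) :
    (decimate m P).map f = decimate m (P.map f) := by
  ext n
  simp [decimate]

lemma constantCoeff_decimate (m : ℕ) (P : PowerSeries A) :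
    PowerSeries.constantCoeff (decimate m P) = PowerSeries.constantCoeff P := by
  simp [decimate]

lemma decimate_X_pow_mul {m : ℕ} (hm : 0 < m) (e : ℕ) (P : PowerSeries A) :
    decimate m (PowerSeries.X ^ (m * e) * P) = PowerSeries.X ^ e * decimate m P := by
  ext n
  simp only [decimate, PowerSeries.coeff_mk, PowerSeries.coeff_X_pow_mul', Nat.mul_sub,
    Nat.mul_le_mul_left_iff hm]

lemma exists_X_pow_mul_sub_X_pow_mul_eq {P Q : PowerSeries A} {i j : ℕ} (hij : i ≠ j)
    (hP : IsUnit (PowerSeries.constantCoeff P)) (hQ : IsUnit (PowerSeries.constantCoeff Q)) :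
    ∃ U : PowerSeries A, IsUnit (PowerSeries.constantCoeff U) ∧
      PowerSeries.X ^ i * P - PowerSeries.X ^ j * Q = PowerSeries.X ^ min i j * U := by
  wlog hlt : i < j generalizing P Q i j
  · obtain ⟨U, hU, h⟩ := this hij.symm hQ hP (hij.lt_or_gt.resolve_left hlt)
    exact ⟨-U, by simpa using hU, by rw [mul_neg, min_comm, ← h, neg_sub]⟩
  refine ⟨P - PowerSeries.X ^ (j - i) * Q, by simpa [(Nat.sub_pos_of_lt hlt).ne'] using hP, ?_⟩
  rw [min_eq_left hlt.le, mul_sub, ← mul_assoc, ← pow_add, Nat.add_sub_cancel' hlt.le]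

lemma exists_prod_eq_X_pow_mul {ι : Type*} (N : ℕ) (s : Finset ι) (P : ι → PowerSeries A)
    (h : ∀ i ∈ s, ∃ e ≤ N, ∃ U : PowerSeries A, IsUnit (PowerSeries.constantCoeff U) ∧
      P i = PowerSeries.X ^ e * U) :
    ∃ e ≤ N * s.card, ∃ U : PowerSeries A, IsUnit (PowerSeries.constantCoeff U) ∧
      ∏ i ∈ s, P i = PowerSeries.X ^ e * U := by
  classical
  induction s using Finset.induction_on with
  | empty => exact ⟨0, le_rfl, 1, by simp, by simp⟩
  | insert i s hi ih =>
    obtain ⟨e, he, U, hU, hs⟩ := ih fun j hj => h j (Finset.mem_insert_of_mem hj)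
    obtain ⟨e', he', U', hU', hPi⟩ := h i (Finset.mem_insert_self _ _)
    refine ⟨e' + e, ?_, U' * U, by simpa using hU'.mul hU, ?_⟩
    · rw [Finset.card_insert_of_notMem hi, mul_add, mul_one]
      lia
    · rw [Finset.prod_insert hi, hs, hPi, pow_add]
      ring

lemma leadingCoeff_jPoly {N : ℕ} {P : PowerSeries A} (hP : PowerSeries.constantCoeff P ≠ 0) :
    (jPoly N P).leadingCoeff = PowerSeries.constantCoeff P := by
  have hdeg : (jPoly N P).natDegree = N :=
    le_antisymm (natDegree_jPoly_le N P)
      (Polynomial.le_natDegree_of_ne_zero (by rwa [coeff_jPoly]))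
  rw [Polynomial.leadingCoeff, hdeg, coeff_jPoly]

end PowerSeries

lemma hasSum_expand_rescale {P : PowerSeries ℂ} {k : ℕ} (hk : k ≠ 0) {ζ y s : ℂ}
    (h : HasSum (fun n => P.coeff n * (ζ * y ^ k) ^ n) s) :
    HasSum (fun n => (PowerSeries.expand k hk (PowerSeries.rescale ζ P)).coeff n * y ^ n) s := by
  rw [← (mul_right_injective₀ hk).hasSum_iff]
  · convert! h using 2 with n
    simp only [comp_apply, PowerSeries.coeff_expand_mul, PowerSeries.coeff_rescale]
    ring
  · intro n hn
    rw [PowerSeries.coeff_expand_of_not_dvd, zero_mul]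
    rintro ⟨j, rfl⟩
    exact hn ⟨j, rfl⟩

lemma qParam_pow_self {m : ℕ} (hm : m ≠ 0) (τ : ℂ) :
    Periodic.qParam m τ ^ m = Periodic.qParam 1 τ := by
  have : (m : ℂ) ≠ 0 := Nat.cast_ne_zero.2 hm
  rw [Periodic.qParam, Periodic.qParam, ← Complex.exp_nat_mul]
  congr 1
  push_cast
  field_simp

lemma qParam_one_vadd (h : ℝ) (τ : ℍ) : Periodic.qParam h (((1 : ℝ) +ᵥ τ : ℍ) : ℂ) =
    Complex.exp (2 * Real.pi * Complex.I / h) * Periodic.qParam h τ := by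
  rw [Periodic.qParam, Periodic.qParam, ← Complex.exp_add, coe_vadd]
  congr 1
  push_cast
  ring

namespace HasQExp

variable {h : ℝ} {P : PowerSeries ℂ} {f : ℍ → ℂ}

lemma expand_rescale (hf : HasQExp 1 P f) {k : ℕ} (hk : k ≠ 0) {ζ : ℂ} {g : ℍ → ℍ}
    (hg : ∀ τ : ℍ, Periodic.qParam 1 (g τ) = ζ * Periodic.qParam h τ ^ k) :
    HasQExp h (PowerSeries.expand k hk (PowerSeries.rescale ζ P)) (fun τ => f (g τ)) := fun τ =>
  hasSum_expand_rescale hk (by simpa only [hg] using hf (g τ))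

lemma coeff_eq_zero_of_periodic {m : ℕ} (hm : m ≠ 0) (hf : HasQExp m P f)
    (hper : ∀ τ : ℍ, f ((1 : ℝ) +ᵥ τ) = f τ) {n : ℕ} (hn : ¬ m ∣ n) : P.coeff n = 0 := by
  set ω : ℂ := Complex.exp (2 * Real.pi * Complex.I / m) with hω
  have hrescale : HasQExp m (PowerSeries.rescale ω P) f := fun τ => by
    have hsum := hf ((1 : ℝ) +ᵥ τ)
    simp only [hper, qParam_one_vadd, ofReal_natCast, ← hω, mul_pow] at hsum
    simpa only [PowerSeries.coeff_rescale, mul_left_comm, mul_assoc] using hsum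
  have hcoeff := congrArg (PowerSeries.coeff n)
    (hrescale.unique (by exact_mod_cast Nat.pos_of_ne_zero hm) hf)
  rw [PowerSeries.coeff_rescale] at hcoeff
  by_contra h0
  have hωn : ω ^ n = 1 := mul_right_cancel₀ h0 (by rw [hcoeff, one_mul])
  exact hn ((Complex.isPrimitiveRoot_exp m hm).dvd_of_pow_eq_one n hωn)

lemma decimate_of_periodic {m : ℕ} (hm : m ≠ 0) (hf : HasQExp m P f)
    (hper : ∀ τ : ℍ, f ((1 : ℝ) +ᵥ τ) = f τ) : HasQExp 1 (decimate m P) f := fun τ => by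
  have hsum := hf τ
  rw [← (mul_right_injective₀ hm).hasSum_iff] at hsum
  · convert! hsum using 2 with n
    simp only [decimate, comp_apply, PowerSeries.coeff_mk, pow_mul, qParam_pow_self hm]
  · intro n hn
    rw [hf.coeff_eq_zero_of_periodic hm hper, zero_mul]
    rintro ⟨j, rfl⟩
    exact hn ⟨j, rfl⟩

end HasQExp

namespace HeckeTriple

variable {m : ℕ}

/-- The root of unity `exp (2πi b / d)`. -/
def root (t : HeckeTriple m) : ℂ := Complex.exp (2 * Real.pi * Complex.I / t.d) ^ t.b

lemma isPrimitiveRoot (t : HeckeTriple m) :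
    IsPrimitiveRoot (Complex.exp (2 * Real.pi * Complex.I / t.d)) t.d :=
  Complex.isPrimitiveRoot_exp _ t.d_pos.ne'

lemma root_pow (t : HeckeTriple m) : t.root ^ t.d = 1 := by
  rw [root, ← pow_mul, mul_comm t.b, pow_mul, t.isPrimitiveRoot.pow_eq_one, one_pow]

lemma ext_root {t t' : HeckeTriple m} (ha : t.a = t'.a) (hd : t.d = t'.d)
    (hr : t.root = t'.root) : t = t' := by
  refine HeckeTriple.ext ha (t.isPrimitiveRoot.pow_inj t.b_lt (hd ▸ t'.b_lt) ?_) hd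
  rwa [root, root, ← hd] at hr

lemma exists_root_eq (σ : ℂ →+* ℂ) (t : HeckeTriple m) :
    ∃ t' : HeckeTriple m, t'.a = t.a ∧ t'.d = t.d ∧ t'.root = σ t.root := by
  have : NeZero t.d := ⟨t.d_pos.ne'⟩
  obtain ⟨i, hi, h⟩ := t.isPrimitiveRoot.eq_pow_of_pow_eq_one
    (ξ := σ t.root) (by rw [← map_pow, t.root_pow, map_one])
  refine ⟨⟨t.a, i, t.d, t.mul_eq, hi, ?_⟩, rfl, rfl, h⟩
  rintro ⟨had, rfl⟩
  refine t.not_scalar ⟨had, t.isPrimitiveRoot.pow_inj t.b_lt t.d_pos (σ.injective ?_)⟩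
  rw [pow_zero, map_one, ← root, ← h, pow_zero]

variable [NeZero m]

lemma qParam_point (t : HeckeTriple m) (τ : ℍ) :
    Periodic.qParam 1 (t.point τ) = t.root * Periodic.qParam m τ ^ (t.a ^ 2) := by
  have hd : (t.d : ℂ) ≠ 0 := Nat.cast_ne_zero.2 t.d_pos.ne'
  have hmd : (m : ℂ) = t.a * t.d := by exact_mod_cast t.mul_eq.symm
  rw [Periodic.qParam, Periodic.qParam, root, ← Complex.exp_nat_mul, ← Complex.exp_nat_mul,
    ← Complex.exp_add]
  congr 1
  simp only [point, UpperHalfPlane.coe_mk]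
  push_cast
  rw [hmd]
  field_simp
  ring

end HeckeTriple

section heckeSeries

variable {A B : Type*} [CommRing A] [CommRing B] {m : ℕ} [NeZero m]

/-- The expansion of `j(τ) - j((a τ + b) / d)` in powers of `exp (2πiτ/m)`, times the `m²`-th
power of that variable, for `ζ = exp (2πi b / d)`. The ring is arbitrary so that `ζ` may also be
taken in the ring of algebraic integers. -/
def heckeFactor (t : HeckeTriple m) (ζ : A) : PowerSeries A :=
  PowerSeries.X ^ (m ^ 2 - m) *
      PowerSeries.expand m (NeZero.ne m) (jSeries.map (Int.castRingHom A))
    - PowerSeries.X ^ (m ^ 2 - t.a ^ 2) * (PowerSeries.C (ζ ^ (t.d - 1)) *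
      PowerSeries.expand (t.a ^ 2) (pow_ne_zero 2 t.a_pos.ne')
        (PowerSeries.rescale ζ (jSeries.map (Int.castRingHom A))))

/-- The expansion of `heckeProduct m` in powers of `exp (2πiτ/m)`, up to a power of the variable,
for `ζ t = exp (2πi b / d)`. -/
def heckeSeries (ζ : HeckeTriple m → A) : PowerSeries A := ∏ t, heckeFactor t (ζ t)

lemma map_heckeFactor (f : A →+* B) (t : HeckeTriple m) (ζ : A) :
    (heckeFactor t ζ).map f = heckeFactor t (f ζ) := by
  have hj : jSeries.map (Int.castRingHom B) = (jSeries.map (Int.castRingHom A)).map f := by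
    ext n
    simp [PowerSeries.coeff_map]
  simp only [heckeFactor, hj, map_sub, map_mul, map_pow, PowerSeries.map_X, PowerSeries.map_C,
    PowerSeries.map_expand, PowerSeries.rescale_map]

lemma map_heckeSeries (f : A →+* B) (ζ : HeckeTriple m → A) :
    (heckeSeries ζ).map f = heckeSeries fun t => f (ζ t) := by
  simp only [heckeSeries, map_prod, map_heckeFactor]

lemma heckeFactor_congr {t t' : HeckeTriple m} (ha : t.a = t'.a) (hd : t.d = t'.d) (ζ : A) :
    heckeFactor t ζ = heckeFactor t' ζ := by
  obtain ⟨a, b, d⟩ := t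
  obtain ⟨a', b', d'⟩ := t'
  subst ha hd
  rfl

lemma exists_heckeFactor_eq (hsq : ¬ IsSquare m) (t : HeckeTriple m) {ζ : A} (hζ : IsUnit ζ) :
    ∃ e ≤ m ^ 2, ∃ U : PowerSeries A, IsUnit (PowerSeries.constantCoeff U) ∧
      heckeFactor t ζ = PowerSeries.X ^ e * U := by
  have ha : t.a ^ 2 ≠ m := fun h => hsq ⟨t.a, h.symm.trans (sq _)⟩
  have hm : m ≤ m ^ 2 := Nat.le_self_pow two_ne_zero m
  have ham : t.a ^ 2 ≤ m ^ 2 := Nat.pow_le_pow_left t.a_le 2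
  have hj : PowerSeries.constantCoeff (jSeries.map (Int.castRingHom A)) = 1 := by
    rw [constantCoeff_map_eq, constantCoeff_jSeries, map_one]
  have hrescale : PowerSeries.constantCoeff
      (PowerSeries.rescale ζ (jSeries.map (Int.castRingHom A))) = 1 := by
    rw [← PowerSeries.coeff_zero_eq_constantCoeff_apply, PowerSeries.coeff_rescale, pow_zero,
      one_mul, PowerSeries.coeff_zero_eq_constantCoeff_apply, hj]
  obtain ⟨U, hU, h⟩ := exists_X_pow_mul_sub_X_pow_mul_eq (i := m ^ 2 - m) (j := m ^ 2 - t.a ^ 2)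
    (P := PowerSeries.expand m (NeZero.ne m) (jSeries.map (Int.castRingHom A)))
    (Q := PowerSeries.C (ζ ^ (t.d - 1)) * PowerSeries.expand (t.a ^ 2)
      (pow_ne_zero 2 t.a_pos.ne') (PowerSeries.rescale ζ (jSeries.map (Int.castRingHom A))))
    (by lia) (by simp [hj]) (by simp [hrescale, hζ.pow])
  exact ⟨_, (min_le_left _ _).trans (Nat.sub_le _ _), U, hU, h⟩

lemma exists_heckeSeries_eq (hsq : ¬ IsSquare m) {ζ : HeckeTriple m → A}
    (hζ : ∀ t, IsUnit (ζ t)) :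
    ∃ e ≤ m ^ 2 * Fintype.card (HeckeTriple m), ∃ U : PowerSeries A,
      IsUnit (PowerSeries.constantCoeff U) ∧ heckeSeries ζ = PowerSeries.X ^ e * U :=
  exists_prod_eq_X_pow_mul (m ^ 2) Finset.univ _ fun t _ => exists_heckeFactor_eq hsq t (hζ t)

end heckeSeries

section modularPoly

variable {m : ℕ} [NeZero m]

lemma hasQExp_heckeFactor (t : HeckeTriple m) : HasQExp m (heckeFactor t t.root)
    (fun τ => Periodic.qParam m τ ^ (m ^ 2) * (modularJ τ - matrixJ t.mat τ)) := by
  have hj : HasQExp m (PowerSeries.expand m (NeZero.ne m) (jSeries.map (Int.castRingHom ℂ)))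
      (fun τ => Periodic.qParam 1 τ * modularJ τ) := by
    simpa using hasQExp_modularJ.expand_rescale (h := m) (ζ := 1) (g := id) (NeZero.ne m)
      fun τ => by rw [one_mul, qParam_pow_self (NeZero.ne m), id]
  have hjt := hasQExp_modularJ.expand_rescale (pow_ne_zero 2 t.a_pos.ne') t.qParam_point
  have hsub := ((HasQExp.X_pow m (m ^ 2 - m)).mul hj).sub
    ((HasQExp.X_pow m (m ^ 2 - t.a ^ 2)).mul ((HasQExp.const m (t.root ^ (t.d - 1))).mul hjt))
  convert! hsub using 1
  ext τ
  simp only [Pi.sub_apply, Pi.mul_apply, t.qParam_point, ← t.matrixJ_eq,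
    ← qParam_pow_self (NeZero.ne m)]
  set q := Periodic.qParam m (τ : ℂ)
  have hm : q ^ (m ^ 2) = q ^ (m ^ 2 - m) * q ^ m := by
    rw [← pow_add, Nat.sub_add_cancel (Nat.le_self_pow two_ne_zero m)]
  have ha : q ^ (m ^ 2) = q ^ (m ^ 2 - t.a ^ 2) * q ^ (t.a ^ 2) := by
    rw [← pow_add, Nat.sub_add_cancel (Nat.pow_le_pow_left t.a_le 2)]
  have hroot : t.root ^ (t.d - 1) * t.root = 1 := by
    rw [← pow_succ, Nat.sub_add_cancel t.d_pos, t.root_pow]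
  linear_combination modularJ τ * hm - matrixJ t.mat τ * ha +
    matrixJ t.mat τ * q ^ (m ^ 2 - t.a ^ 2) * q ^ (t.a ^ 2) * hroot

lemma hasQExp_heckeSeries : HasQExp m (heckeSeries (HeckeTriple.root (m := m)))
    (fun τ => Periodic.qParam 1 τ ^ (m * Fintype.card (HeckeTriple m)) * heckeProduct m τ) := by
  convert! HasQExp.prod Finset.univ fun t _ => hasQExp_heckeFactor (m := m) t using 1
  ext τ
  rw [heckeProduct, Finset.prod_apply, Finset.prod_mul_distrib, Finset.prod_const,
    ← qParam_pow_self (NeZero.ne m), Finset.card_univ]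
  ring

lemma qParam_pow_mul_heckeProduct_one_vadd (N : ℕ) (τ : ℍ) :
    Periodic.qParam 1 (((1 : ℝ) +ᵥ τ : ℍ) : ℂ) ^ N * heckeProduct m ((1 : ℝ) +ᵥ τ) =
      Periodic.qParam 1 τ ^ N * heckeProduct m τ := by
  rw [qParam_one_vadd, ofReal_one, div_one, exp_two_pi_mul_I, one_mul, ← modular_T_smul,
    heckeProduct_smul]

/-- The polynomial `f` with `heckeProduct m = f(j)`, i.e. the diagonal `Φ(X, X)` of the modular
equation, with the factor of the scalar matrix removed when `m` is a square. -/
def modularPoly (m : ℕ) [NeZero m] : ℂ[X] :=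
  jPoly (m * Fintype.card (HeckeTriple m)) (decimate m (heckeSeries (HeckeTriple.root (m := m))))

lemma heckeProduct_eq_eval (τ : ℍ) : heckeProduct m τ = (modularPoly m).eval (modularJ τ) :=
  eq_eval_jPoly (hasQExp_heckeSeries.decimate_of_periodic (NeZero.ne m)
    (qParam_pow_mul_heckeProduct_one_vadd _)) heckeProduct_smul τ

lemma isRoot_modularPoly_iff (τ : ℍ) :
    (modularPoly m).IsRoot (modularJ τ) ↔ m ∈ normSet (multipliers (upperLattice τ)) := by
  rw [← heckeProduct_eq_zero_iff, heckeProduct_eq_eval, Polynomial.IsRoot.def]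

/-- `σ` permutes the roots of unity `exp (2πi b / d)` with the same `a` and `d`. -/
lemma map_heckeSeries_root (σ : ℂ →+* ℂ) :
    (heckeSeries (HeckeTriple.root (m := m))).map σ =
      heckeSeries (HeckeTriple.root (m := m)) := by
  choose e ha hd hr using HeckeTriple.exists_root_eq (m := m) σ
  have hinj : Injective e := fun t t' h =>
    HeckeTriple.ext_root (by rw [← ha, h, ha]) (by rw [← hd, h, hd])
      (σ.injective (by rw [← hr, h, hr]))
  rw [map_heckeSeries]
  exact Fintype.prod_bijective e (Finite.injective_iff_bijective.1 hinj) _ _ fun t => by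
    rw [heckeFactor_congr (ha t) (hd t), hr]

lemma map_modularPoly (σ : ℂ →+* ℂ) : (modularPoly m).map σ = modularPoly m := by
  rw [modularPoly, map_jPoly, map_decimate, map_heckeSeries_root]

lemma exists_map_eq_modularPoly (hsq : ¬ IsSquare m) :
    ∃ f : (integralClosure ℤ ℂ)[X], IsUnit f.leadingCoeff ∧
      f.map (algebraMap (integralClosure ℤ ℂ) ℂ) = modularPoly m := by
  have hint (t : HeckeTriple m) : t.root ∈ integralClosure ℤ ℂ :=
    IsIntegral.of_pow t.d_pos (by rw [t.root_pow]; exact isIntegral_one)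
  have hunit (t : HeckeTriple m) : IsUnit (⟨t.root, hint t⟩ : integralClosure ℤ ℂ) :=
    IsUnit.of_pow_eq_one (Subtype.ext t.root_pow) t.d_pos.ne'
  obtain ⟨E, hE, U, hU, h⟩ := exists_heckeSeries_eq hsq hunit
  have hmap := map_heckeSeries (algebraMap (integralClosure ℤ ℂ) ℂ) fun t : HeckeTriple m =>
    ⟨t.root, hint t⟩
  change _ = heckeSeries HeckeTriple.root at hmap
  obtain ⟨e, rfl⟩ : m ∣ E := by
    by_contra hdvd
    have hcoeff := hasQExp_heckeSeries.coeff_eq_zero_of_periodic (NeZero.ne m)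
      (qParam_pow_mul_heckeProduct_one_vadd _) hdvd
    rw [← hmap, PowerSeries.coeff_map, h, PowerSeries.coeff_X_pow_mul', if_pos le_rfl,
      Nat.sub_self, PowerSeries.coeff_zero_eq_constantCoeff_apply] at hcoeff
    exact (hU.map _).ne_zero hcoeff
  have he : e ≤ m * Fintype.card (HeckeTriple m) :=
    Nat.le_of_mul_le_mul_left (hE.trans_eq (by ring)) (NeZero.pos m)
  refine ⟨jPoly (m * Fintype.card (HeckeTriple m) - e) (decimate m U), ?_, ?_⟩
  · rw [leadingCoeff_jPoly] <;> rw [constantCoeff_decimate]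
    exacts [hU, hU.ne_zero]
  · rw [modularPoly, ← hmap, ← map_decimate, ← map_jPoly, h, decimate_X_pow_mul (NeZero.pos m)]
    conv_rhs => rw [← Nat.sub_add_cancel he, jPoly_X_pow_mul]

lemma modularPoly_ne_zero (hsq : ¬ IsSquare m) : modularPoly m ≠ 0 := by
  obtain ⟨f, hu, hf⟩ := exists_map_eq_modularPoly hsq
  rw [← hf, Polynomial.map_ne_zero_iff (FaithfulSMul.algebraMap_injective _ ℂ)]
  exact Polynomial.leadingCoeff_ne_zero.1 hu.ne_zero

lemma isIntegral_of_isRoot_modularPoly (hsq : ¬ IsSquare m) {x : ℂ}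
    (hx : (modularPoly m).IsRoot x) : IsIntegral ℤ x := by
  obtain ⟨f, ⟨u, hu⟩, hf⟩ := exists_map_eq_modularPoly hsq
  rw [← hf, Polynomial.IsRoot.def, Polynomial.eval_map] at hx
  refine isIntegral_trans (A := integralClosure ℤ ℂ) x
    ⟨Polynomial.C (↑u⁻¹ : integralClosure ℤ ℂ) * f, ?_, ?_⟩
  · rw [Polynomial.Monic, Polynomial.leadingCoeff_mul, Polynomial.leadingCoeff_C, ← hu,
      Units.inv_mul]
  · rw [Polynomial.eval₂_mul, hx, mul_zero]

lemma mem_normSet_iff_of_modularJ_eq_map (σ : ℂ →+* ℂ) {τ τ' : ℍ}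
    (h : modularJ τ' = σ (modularJ τ)) :
    m ∈ normSet (multipliers (upperLattice τ')) ↔ m ∈ normSet (multipliers (upperLattice τ)) := by
  rw [← isRoot_modularPoly_iff, ← isRoot_modularPoly_iff, h]
  nth_rw 1 [← map_modularPoly σ]
  rw [Polynomial.IsRoot.def, Polynomial.eval_map_apply, map_eq_zero, Polynomial.IsRoot.def]

end modularPoly

/-! ### Imaginary quadratic orders -/

/-- The complex number `(t + u √-d) / 2`. -/
def quadElement (d : ℕ) (t u : ℤ) : ℂ := ⟨t / 2, u * √(d : ℝ) / 2⟩

lemma four_mul_normSq_quadElement (d : ℕ) (t u : ℤ) :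
    4 * Complex.normSq (quadElement d t u) = ((t ^ 2 + u ^ 2 * d : ℤ) : ℝ) := by
  rw [quadElement, Complex.normSq_mk]
  push_cast
  linear_combination u ^ 2 * Real.sq_sqrt (Nat.cast_nonneg (α := ℝ) d)

/-- The order of discriminant `-d` in `ℂ`, for `d` congruent to `0` or `3` modulo `4`. -/
def quadOrder (d : ℕ) : Set ℂ :=
  {x | ∃ t u : ℤ, 2 ∣ t - u * d ∧ x = quadElement d t u}

/-- `τ` is a root of the form `[A, B, C]`, which is primitive and has a positive leading
coefficient. Primitivity is encoded as a Bézout relation. -/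
structure IsPrimitiveForm (τ : ℍ) (A B C : ℤ) : Prop where
  pos : 0 < A
  eq_zero : (A * τ ^ 2 + B * τ + C : ℂ) = 0
  primitive : ∃ p q r : ℤ, p * A + q * B + r * C = 1

lemma exists_eq_mul_primitive {S : Type*} [CommRing S] [IsDomain S] [IsPrincipalIdealRing S]
    {a : S} (b c : S) (ha : a ≠ 0) : ∃ g A B C : S, a = g * A ∧ b = g * B ∧ c = g * C ∧
      ∃ p q r : S, p * A + q * B + r * C = 1 := by
  obtain ⟨g, hg⟩ := IsPrincipalIdealRing.principal (Ideal.span {a, b, c})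
  rw [← Ideal.span] at hg
  have hdvd {x : S} (hx : x ∈ ({a, b, c} : Set S)) : g ∣ x :=
    Ideal.mem_span_singleton.1 (hg ▸ Ideal.subset_span hx)
  obtain ⟨A, rfl⟩ := hdvd (Set.mem_insert _ _)
  obtain ⟨B, rfl⟩ := hdvd (Set.mem_insert_of_mem _ (Set.mem_insert _ _))
  obtain ⟨C, rfl⟩ := hdvd (Set.mem_insert_of_mem _ (Set.mem_insert_of_mem _ rfl))
  obtain ⟨p, q, r, h⟩ := Submodule.mem_span_triple.1
    (hg.symm ▸ Ideal.mem_span_singleton_self g : g ∈ Ideal.span {g * A, g * B, g * C})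
  refine ⟨g, A, B, C, rfl, rfl, rfl, p, q, r, mul_left_cancel₀ (left_ne_zero_of_mul ha) ?_⟩
  simp only [smul_eq_mul] at h
  linear_combination h

lemma exists_isPrimitiveForm {τ : ℍ} {x : ℂ} (hx : x ∈ multipliers (upperLattice τ))
    (him : x.im ≠ 0) : ∃ A B C : ℤ, IsPrimitiveForm τ A B C := by
  obtain ⟨M, hM⟩ := mem_multipliers_upperLattice.1 hx
  obtain ⟨h0, h1⟩ := periods_eq_smul_iff.1 hM
  have hc : M 1 0 ≠ 0 := by
    intro h
    simp [← h1, h] at him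
  obtain ⟨g, A, B, C, hA, hB, hC, p, q, r, hpqr⟩ :=
    exists_eq_mul_primitive (M 1 1 - M 0 0) (-M 0 1) hc
  have hroot : (A * τ ^ 2 + B * τ + C : ℂ) = 0 := by
    have hg : (g : ℂ) ≠ 0 := Int.cast_ne_zero.2 (left_ne_zero_of_mul (hA ▸ hc))
    have hA' := congrArg (Int.cast : ℤ → ℂ) hA
    have hB' := congrArg (Int.cast : ℤ → ℂ) hB
    have hC' := congrArg (Int.cast : ℤ → ℂ) hC
    push_cast at hA' hB' hC'
    refine mul_left_cancel₀ hg ?_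
    linear_combination τ * h1 - h0 - τ ^ 2 * hA' - τ * hB' - hC'
  rcases lt_or_gt_of_ne (right_ne_zero_of_mul (hA ▸ hc)) with h | h
  · refine ⟨-A, -B, -C, neg_pos.2 h, ?_, -p, -q, -r, by linear_combination hpqr⟩
    push_cast
    linear_combination -hroot
  · exact ⟨A, B, C, h, hroot, p, q, r, hpqr⟩

namespace IsPrimitiveForm

variable {τ : ℍ} {A B C : ℤ} {d : ℕ}

lemma mem_multipliers_iff (h : IsPrimitiveForm τ A B C) {x : ℂ} :
    x ∈ multipliers (upperLattice τ) ↔ ∃ p q : ℤ, x = p + q * (A * τ) := by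
  rw [mem_multipliers_upperLattice]
  constructor
  · rintro ⟨M, hM⟩
    obtain ⟨h0, h1⟩ := periods_eq_smul_iff.1 hM
    have hAM : A • M = !![A * M 1 1 - M 1 0 * B, -(M 1 0 * C); A * M 1 0, A * M 1 1] := by
      refine periods_injective τ (funext fun i => ?_)
      fin_cases i
      · simp only [periods_apply, Matrix.smul_apply, smul_eq_mul, Fin.zero_eta, Matrix.of_apply,
          Matrix.cons_val_zero, Matrix.cons_val_one]
        push_cast
        linear_combination A * h0 - A * τ * h1 + M 1 0 * h.eq_zero
      · simp only [periods_apply, Matrix.smul_apply, smul_eq_mul, Fin.mk_one, Matrix.of_apply,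
          Matrix.cons_val_zero, Matrix.cons_val_one]
    have h00 : A * M 0 0 = A * M 1 1 - M 1 0 * B := congrFun (congrFun hAM 0) 0
    have h01 : A * M 0 1 = -(M 1 0 * C) := congrFun (congrFun hAM 0) 1
    obtain ⟨p, q, r, hpqr⟩ := h.primitive
    have h10 : M 1 0 = A * (p * M 1 0 + q * (M 1 1 - M 0 0) - r * M 0 1) := by
      linear_combination -M 1 0 * hpqr + q * h00 + r * h01
    have h10' := congrArg (Int.cast : ℤ → ℂ) h10
    refine ⟨M 1 1, p * M 1 0 + q * (M 1 1 - M 0 0) - r * M 0 1, ?_⟩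
    rw [← h1]
    push_cast at h10' ⊢
    linear_combination τ * h10'
  · rintro ⟨p, q, rfl⟩
    refine ⟨!![p - q * B, -(q * C); q * A, p], periods_eq_smul_iff.2 ⟨?_, ?_⟩⟩ <;>
      simp only [Matrix.of_apply, Matrix.cons_val_zero, Matrix.cons_val_one] <;> push_cast
    · linear_combination -q * h.eq_zero
    · ring

lemma im_pos (h : IsPrimitiveForm τ A B C) : 0 < 2 * A * τ.im :=
  mul_pos (mul_pos two_pos (Int.cast_pos.2 h.pos)) τ.im_pos

lemma re_eq (h : IsPrimitiveForm τ A B C) : 2 * A * τ.re = -B := by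
  have him := congrArg Complex.im h.eq_zero
  simp only [pow_two, add_im, mul_im, intCast_re, intCast_im, coe_re, coe_im, zero_im] at him
  refine mul_right_cancel₀ τ.im_ne_zero ?_
  linear_combination him

lemma disc_eq (h : IsPrimitiveForm τ A B C) :
    ((4 * A * C - B ^ 2 : ℤ) : ℝ) = (2 * A * τ.im) ^ 2 := by
  have hre := congrArg Complex.re h.eq_zero
  simp only [pow_two, add_re, mul_re, mul_im, intCast_re, intCast_im, coe_re, coe_im, zero_re]
    at hre
  push_cast
  linear_combination 4 * A * hre - (2 * A * τ.re + B) * h.re_eq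

lemma disc_pos (h : IsPrimitiveForm τ A B C) : 0 < 4 * A * C - B ^ 2 := by
  have := h.disc_eq ▸ pow_pos h.im_pos 2
  exact_mod_cast this

lemma add_mul_eq_quadElement (h : IsPrimitiveForm τ A B C) (hd : (d : ℤ) = 4 * A * C - B ^ 2)
    (p q : ℤ) : (p + q * (A * τ) : ℂ) = quadElement d (2 * p - q * B) q := by
  have hsqrt : √(d : ℝ) = 2 * A * τ.im := by
    rw [← Int.cast_natCast, hd, h.disc_eq, Real.sqrt_sq h.im_pos.le]
  apply Complex.ext
  · simp only [quadElement, add_re, mul_re, mul_im, intCast_re, intCast_im, coe_re, coe_im]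
    push_cast
    linear_combination q / 2 * h.re_eq
  · simp only [quadElement, add_im, mul_re, mul_im, intCast_re, intCast_im, coe_re, coe_im, hsqrt]
    ring

lemma multipliers_eq (h : IsPrimitiveForm τ A B C) (hd : (d : ℤ) = 4 * A * C - B ^ 2) :
    multipliers (upperLattice τ) = quadOrder d := by
  have hparity : 2 ∣ (d : ℤ) - B := by
    obtain ⟨k, hk⟩ := Int.even_mul_succ_self B
    exact ⟨2 * A * C - k, by rw [hd]; linear_combination -hk⟩
  ext x
  rw [h.mem_multipliers_iff]
  constructor
  · rintro ⟨p, q, rfl⟩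
    refine ⟨2 * p - q * B, q, ?_, h.add_mul_eq_quadElement hd p q⟩
    exact (dvd_add (dvd_mul_right 2 (p - q * B)) (hparity.mul_left (-q))).trans
      (dvd_of_eq (by ring))
  · rintro ⟨t, u, htu, rfl⟩
    obtain ⟨p, hp⟩ : 2 ∣ t + u * B :=
      (dvd_add (htu.add (hparity.mul_left u)) (dvd_mul_right 2 (u * B))).trans
        (dvd_of_eq (by ring))
    exact ⟨p, u, by rw [h.add_mul_eq_quadElement hd, ← hp, add_sub_cancel_right]⟩

lemma disc_mod_four (hd : (d : ℤ) = 4 * A * C - B ^ 2) : d % 4 = 0 ∨ d % 4 = 3 := by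
  rw [mul_assoc] at hd
  rcases Int.even_or_odd' B with ⟨k, hk | hk⟩
  · have : B ^ 2 = 4 * k ^ 2 := by rw [hk]; ring
    omega
  · have : B ^ 2 = 4 * (k ^ 2 + k) + 1 := by rw [hk]; ring
    omega

end IsPrimitiveForm

lemma exists_multipliers_eq_quadOrder {τ : ℍ} {x : ℂ} (hx : x ∈ multipliers (upperLattice τ))
    (him : x.im ≠ 0) : ∃ d : ℕ, 0 < d ∧ (d % 4 = 0 ∨ d % 4 = 3) ∧
      multipliers (upperLattice τ) = quadOrder d := by
  obtain ⟨A, B, C, h⟩ := exists_isPrimitiveForm hx him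
  obtain ⟨d, hd⟩ := Int.eq_ofNat_of_zero_le h.disc_pos.le
  exact ⟨d, by have := h.disc_pos; omega, IsPrimitiveForm.disc_mod_four hd.symm,
    h.multipliers_eq hd.symm⟩

/-! ### The norms of an imaginary quadratic order -/

lemma mem_normSet_quadOrder {d : ℕ} (hd : d ≠ 0) {m : ℕ} (hm : 1 < m) (t : ℤ) (ht : 2 ∣ t - d)
    (htm : t ^ 2 + d = 4 * m) : m ∈ normSet (quadOrder d) := by
  have hnorm : Complex.normSq (quadElement d t 1) = m := by
    have := four_mul_normSq_quadElement d t 1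
    rw [one_pow, one_mul, htm] at this
    push_cast at this
    linarith
  refine ⟨quadElement d t 1, ⟨t, 1, by rwa [one_mul], rfl⟩, hnorm, ?_⟩
  rintro s _ ⟨v, w, -, rfl⟩ hunit hsu
  have hsw : s * w = 1 := by
    have him := congrArg Complex.im hsu
    simp only [quadElement, mul_im, intCast_re, intCast_im, zero_mul, add_zero, Int.cast_one,
      one_mul] at him
    have hsqrt : √(d : ℝ) ≠ 0 := Real.sqrt_ne_zero'.2 (by positivity)
    have : (s * w : ℝ) = 1 := mul_right_cancel₀ hsqrt (by linear_combination -2 * him)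
    exact_mod_cast this
  have hs : (s : ℝ) * s = 1 := by
    rcases Int.eq_one_or_neg_one_of_mul_eq_one hsw with rfl | rfl <;> norm_num
  rw [hsu, map_mul, hunit, mul_one, normSq_intCast, hs] at hnorm
  exact hm.ne (by exact_mod_cast hnorm)

lemma exists_of_mem_normSet_quadOrder {d m : ℕ} (h : m ∈ normSet (quadOrder d)) :
    ∃ t u : ℤ, u ≠ 0 ∧ t ^ 2 + u ^ 2 * d = 4 * m := by
  obtain ⟨_, ⟨t, u, htu, rfl⟩, hm, hprim⟩ := h
  refine ⟨t, u, ?_, ?_⟩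
  · rintro rfl
    obtain ⟨k, hk⟩ := htu
    rw [zero_mul, sub_zero] at hk
    refine hprim k 1 ⟨2, 0, by simp, ?_⟩ (map_one _) ?_ <;>
      apply Complex.ext <;> simp [quadElement, hk]
  · have := four_mul_normSq_quadElement d t u
    rw [hm] at this
    exact_mod_cast this.symm

lemma le_of_mem_normSet_quadOrder {d m : ℕ} (h : m ∈ normSet (quadOrder d)) : d ≤ 4 * m := by
  obtain ⟨t, u, hu, hm⟩ := exists_of_mem_normSet_quadOrder h
  have hu1 : 1 ≤ u ^ 2 := Order.one_le_iff_pos.2 (sq_pos_iff.2 hu)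
  have : (d : ℤ) ≤ 4 * m := by nlinarith [sq_nonneg t]
  exact_mod_cast this

lemma div_four_mem_normSet_quadOrder {d : ℕ} (hd : 4 < d) (h4 : d % 4 = 0 ∨ d % 4 = 3) :
    (d + 1) / 4 ∈ normSet (quadOrder d) := by
  rcases h4 with h | h
  · exact mem_normSet_quadOrder (by omega) (by omega) 0 (by omega) (by omega)
  · exact mem_normSet_quadOrder (by omega) (by omega) 1 (by omega) (by omega)

lemma normSet_quadOrder_ne {n : ℕ} (hn : n ≠ 0) :
    normSet (quadOrder (4 * n - 1)) ≠ normSet (quadOrder (4 * n)) := by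
  intro h
  have hmem : n + 1 ∈ normSet (quadOrder (4 * n)) :=
    mem_normSet_quadOrder (by omega) (by omega) 2 (by omega) (by push_cast; ring)
  obtain ⟨t, u, hu, htu⟩ := exists_of_mem_normSet_quadOrder (h ▸ hmem)
  have hn1 : (1 : ℤ) ≤ n := by omega
  have hcast : ((4 * n - 1 : ℕ) : ℤ) = 4 * n - 1 := by omega
  rw [hcast] at htu
  push_cast at htu
  have hu1 : u ^ 2 = 1 := by
    have hlt : u ^ 2 < 2 ^ 2 := by nlinarith [sq_nonneg t]
    obtain ⟨hl, hr⟩ := abs_lt.1 (abs_lt_of_sq_lt_sq hlt two_pos.le)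
    interval_cases u <;> simp_all
  have ht : t ^ 2 = 5 := by
    rw [hu1] at htu
    linarith
  obtain ⟨hl, hr⟩ := abs_lt.1 (abs_lt_of_sq_lt_sq (by rw [ht]; norm_num : t ^ 2 < 3 ^ 2) (by simp))
  interval_cases t <;> omega

/-- The least element of `normSet (quadOrder d)` is `(d + 1) / 4`, which leaves only the pairs
`4 n - 1`, `4 n` to be told apart. -/
lemma eq_of_normSet_quadOrder_eq {d d' : ℕ} (hd : 4 < d) (hd' : 4 < d')
    (h4 : d % 4 = 0 ∨ d % 4 = 3) (h4' : d' % 4 = 0 ∨ d' % 4 = 3)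
    (h : normSet (quadOrder d) = normSet (quadOrder d')) : d = d' := by
  have hle := le_of_mem_normSet_quadOrder (h ▸ div_four_mem_normSet_quadOrder hd' h4')
  have hle' := le_of_mem_normSet_quadOrder (h ▸ div_four_mem_normSet_quadOrder hd h4)
  by_contra hne
  rcases lt_or_gt_of_ne hne with hlt | hlt
  · obtain ⟨n, rfl, rfl⟩ : ∃ n, d = 4 * n - 1 ∧ d' = 4 * n := ⟨d' / 4, by omega, by omega⟩
    exact normSet_quadOrder_ne (by omega) h
  · obtain ⟨n, rfl, rfl⟩ : ∃ n, d' = 4 * n - 1 ∧ d = 4 * n := ⟨d / 4, by omega, by omega⟩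
    exact normSet_quadOrder_ne (by omega) h.symm

/-- `4 m = (d + 2) ^ 2 + d` lies strictly between the squares of `d + 2` and `d + 3`. -/
lemma exists_mem_normSet_quadOrder_not_isSquare {d : ℕ} (hd : 0 < d)
    (h4 : d % 4 = 0 ∨ d % 4 = 3) : ∃ m ∈ normSet (quadOrder d), m ≠ 0 ∧ ¬ IsSquare m := by
  obtain ⟨m, hm⟩ : ∃ m : ℕ, (d + 2) ^ 2 + d = 4 * m := by
    obtain ⟨k, hk | hk⟩ : ∃ k, d = 4 * k ∨ d = 4 * k + 3 := ⟨d / 4, by omega⟩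
    · exact ⟨4 * k ^ 2 + 5 * k + 1, by rw [hk]; ring⟩
    · exact ⟨4 * k ^ 2 + 11 * k + 7, by rw [hk]; ring⟩
  refine ⟨m, mem_normSet_quadOrder hd.ne' (by nlinarith) (d + 2) ⟨1, by ring⟩
    (by exact_mod_cast hm), by rintro rfl; nlinarith, ?_⟩
  rintro ⟨r, rfl⟩
  have hl : d + 2 < 2 * r := by nlinarith
  have hr : 2 * r < d + 3 := by nlinarith
  omega

/-! ### Lattices with extra automorphisms -/

lemma latticeG_eq_zero_of_pow_ne_one {Λ : Submodule ℤ ℂ} {u : ℂ} (hu : u ∈ multipliers Λ)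
    (hu' : u⁻¹ ∈ multipliers Λ) (hu0 : u ≠ 0) {n : ℕ} (hn : u ^ n ≠ 1) : latticeG Λ n = 0 := by
  have h := latticeG_smul Λ Λ u hu0 (fun w => ⟨fun hw => ⟨u⁻¹ * w, hu' w hw, by
    rw [mul_inv_cancel_left₀ hu0]⟩, by rintro ⟨v, hv, rfl⟩; exact hu v hv⟩) n
  have hn' : 1 - (u ^ n)⁻¹ ≠ 0 := sub_ne_zero.2 fun h1 => hn (inv_eq_one.1 h1.symm)
  refine (mul_eq_zero.1 ?_).resolve_left hn'
  linear_combination h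

lemma latticeG_eq_zero_of_multipliers_eq {Λ : Submodule ℤ ℂ} {d : ℕ}
    (h : multipliers Λ = quadOrder d) {t u : ℤ} (htu : 2 ∣ t - u * d)
    (hunit : t ^ 2 + u ^ 2 * d = 4) {n : ℕ} (hn : quadElement d t u ^ n ≠ 1) :
    latticeG Λ n = 0 := by
  have hnorm : Complex.normSq (quadElement d t u) = 1 := by
    have := four_mul_normSq_quadElement d t u
    rw [hunit] at this
    push_cast at this
    linarith
  refine latticeG_eq_zero_of_pow_ne_one (u := quadElement d t u) (h ▸ ⟨t, u, htu, rfl⟩)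
    (h ▸ ⟨t, -u, ?_, ?_⟩) (Complex.normSq_pos.1 (hnorm ▸ one_pos)) hn
  · exact (htu.add (dvd_mul_right 2 (u * d))).trans (dvd_of_eq (by ring))
  · rw [inv_def, hnorm, inv_one, ofReal_one, mul_one]
    apply Complex.ext <;> simp [quadElement, neg_div]

lemma modularJ_eq_zero_of_multipliers_eq {τ : ℍ}
    (h : multipliers (upperLattice τ) = quadOrder 3) : modularJ τ = 0 := by
  have hsq : quadElement 3 1 1 ^ 2 = quadElement 3 1 1 - 1 := by
    rw [pow_two]
    apply Complex.ext
    · simp only [quadElement, mul_re, sub_re, one_re]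
      push_cast
      linear_combination -Real.sq_sqrt (zero_le_three (α := ℝ)) / 4
    · simp only [quadElement, mul_im, sub_im, one_im]
      push_cast
      ring
  have hG : latticeG (upperLattice τ) 4 = 0 := by
    refine latticeG_eq_zero_of_multipliers_eq h (t := 1) (u := 1) (by simp) (by norm_num) ?_
    intro h4
    have hneg : quadElement 3 1 1 = -1 := by
      linear_combination (quadElement 3 1 1 ^ 2 + quadElement 3 1 1) * hsq - h4
    simpa [quadElement] using congrArg Complex.im hneg
  change latticeJ (upperLattice τ) = 0
  simp [latticeJ, latticeG2, hG]

lemma modularJ_eq_of_multipliers_eq {τ : ℍ}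
    (h : multipliers (upperLattice τ) = quadOrder 4) : modularJ τ = 1728 := by
  have hI : quadElement 4 0 1 = Complex.I := by
    have hsqrt : √(4 : ℝ) = 2 := by
      rw [Real.sqrt_eq_iff_mul_self_eq_of_pos two_pos]
      norm_num
    apply Complex.ext <;> simp [quadElement, hsqrt]
  have hG : latticeG (upperLattice τ) 6 = 0 := by
    refine latticeG_eq_zero_of_multipliers_eq h (t := 0) (u := 1) (by norm_num) (by norm_num) ?_
    rw [hI, show 6 = 4 + 2 from rfl, pow_add, I_pow_four, I_sq]
    norm_num
  have hdisc := latticeDisc_upperLattice_ne_zero τ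
  change latticeJ (upperLattice τ) = 1728
  rw [latticeJ, div_eq_iff hdisc]
  simp only [latticeDisc, latticeG3, hG]
  ring

/-! ### Homothetic lattices and conjugate invariants -/

namespace IsHomothetic

variable {Λ Λ' Λ'' : Submodule ℤ ℂ}

lemma symm (h : IsHomothetic Λ Λ') : IsHomothetic Λ' Λ := by
  obtain ⟨z, hz, h⟩ := h
  refine ⟨z⁻¹, inv_ne_zero hz, fun w => ⟨fun hw => ?_, ?_⟩⟩
  · exact ⟨z * w, (h _).2 ⟨w, hw, rfl⟩, (inv_mul_cancel_left₀ hz w).symm⟩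
  · rintro ⟨_, hv, rfl⟩
    obtain ⟨u, hu, rfl⟩ := (h _).1 hv
    rwa [inv_mul_cancel_left₀ hz]

lemma trans (h : IsHomothetic Λ Λ') (h' : IsHomothetic Λ' Λ'') : IsHomothetic Λ Λ'' := by
  obtain ⟨z, hz, h⟩ := h
  obtain ⟨z', hz', h'⟩ := h'
  refine ⟨z' * z, mul_ne_zero hz' hz, fun w => (h' w).trans ⟨?_, ?_⟩⟩
  · rintro ⟨_, hv, rfl⟩
    obtain ⟨u, hu, rfl⟩ := (h _).1 hv
    exact ⟨u, hu, (mul_assoc z' z u).symm⟩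
  · rintro ⟨u, hu, rfl⟩
    exact ⟨z * u, (h _).2 ⟨u, hu, rfl⟩, mul_assoc z' z u⟩

lemma latticeJ_eq (h : IsHomothetic Λ Λ') : latticeJ Λ' = latticeJ Λ := by
  obtain ⟨z, hz, h⟩ := h
  exact latticeJ_smul Λ Λ' z hz h

lemma multipliers_eq (h : IsHomothetic Λ Λ') : multipliers Λ' = multipliers Λ := by
  obtain ⟨z, hz, h⟩ := h
  ext x
  constructor
  · intro hx v hv
    obtain ⟨v', hv', hxv⟩ := (h _).1 (hx (z * v) ((h _).2 ⟨v, hv, rfl⟩))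
    rw [mul_left_comm] at hxv
    rwa [mul_left_cancel₀ hz hxv]
  · intro hx w hw
    obtain ⟨v, hv, rfl⟩ := (h _).1 hw
    exact (h _).2 ⟨x * v, hx v hv, mul_left_comm x z v⟩

end IsHomothetic

lemma one_mem_multipliers (Λ : Submodule ℤ ℂ) : 1 ∈ multipliers Λ := fun v hv => by
  rwa [one_mul]

lemma exists_int_eq_of_mem_multipliers {τ : ℍ} {x : ℂ} (hx : x ∈ multipliers (upperLattice τ))
    (him : x.im = 0) : ∃ n : ℤ, x = n := by
  obtain ⟨m, n, hmn⟩ := mem_upperLattice.1 (hx 1 (mem_upperLattice.2 ⟨0, 1, by simp⟩))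
  rw [mul_one] at hmn
  have hm : (m : ℝ) * τ.im = 0 := by simpa [him] using (congrArg Complex.im hmn).symm
  have hm' : m = 0 := by exact_mod_cast (mul_eq_zero.1 hm).resolve_right τ.im_ne_zero
  exact ⟨n, by rw [hmn, hm', Int.cast_zero, zero_mul, zero_add]⟩

lemma exists_im_ne_zero_of_mem_normSet {τ : ℍ} {m : ℕ}
    (h : m ∈ normSet (multipliers (upperLattice τ))) :
    ∃ x ∈ multipliers (upperLattice τ), x.im ≠ 0 := by
  obtain ⟨x, hx, -, hs⟩ := h
  refine ⟨x, hx, fun him => ?_⟩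
  obtain ⟨n, rfl⟩ := exists_int_eq_of_mem_multipliers hx him
  exact hs n 1 (one_mem_multipliers _) (map_one _) (mul_one _).symm

lemma zero_notMem_normSet {O : Set ℂ} (h : 1 ∈ O) : 0 ∉ normSet O := by
  rintro ⟨x, -, hx, hs⟩
  rw [Nat.cast_zero, Complex.normSq_eq_zero] at hx
  exact hs 0 1 h (map_one _) (by rw [hx, Int.cast_zero, zero_mul])

lemma four_lt_of_multipliers_eq {τ : ℍ} {d : ℕ} (hd : 0 < d) (h4 : d % 4 = 0 ∨ d % 4 = 3)
    (h : multipliers (upperLattice τ) = quadOrder d) (h0 : modularJ τ ≠ 0)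
    (h1728 : modularJ τ ≠ 1728) : 4 < d := by
  have hd3 : d ≠ 3 := by
    rintro rfl
    exact h0 (modularJ_eq_zero_of_multipliers_eq h)
  have hd4 : d ≠ 4 := by
    rintro rfl
    exact h1728 (modularJ_eq_of_multipliers_eq h)
  lia

lemma multipliers_eq_of_modularJ_eq {τ τ' : ℍ} (h : modularJ τ' = modularJ τ) :
    multipliers (upperLattice τ') = multipliers (upperLattice τ) :=
  (isHomothetic_of_modularJ_eq h.symm).multipliers_eq

lemma normSet_eq_of_modularJ_eq_map (σ : ℂ →+* ℂ) {τ τ' : ℍ} (h : modularJ τ' = σ (modularJ τ)) :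
    normSet (multipliers (upperLattice τ')) = normSet (multipliers (upperLattice τ)) := by
  ext m
  rcases eq_or_ne m 0 with rfl | hm
  · exact iff_of_false (zero_notMem_normSet (one_mem_multipliers _))
      (zero_notMem_normSet (one_mem_multipliers _))
  · have : NeZero m := ⟨hm⟩
    exact mem_normSet_iff_of_modularJ_eq_map σ h

/-- The modular polynomials are rational, so conjugation preserves the norms of multipliers. They
determine an order of discriminant below `-4`; the invariants `0` and `1728` belonging to `-3` and
`-4` are fixed by conjugation. -/
lemma multipliers_eq_of_modularJ_eq_map (σ : ℂ →+* ℂ) {τ τ' : ℍ} {x : ℂ}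
    (hx : x ∈ multipliers (upperLattice τ)) (him : x.im ≠ 0) (h : modularJ τ' = σ (modularJ τ)) :
    multipliers (upperLattice τ') = multipliers (upperLattice τ) := by
  rcases eq_or_ne (modularJ τ) 0 with h0 | h0
  · exact multipliers_eq_of_modularJ_eq (by rw [h, h0, map_zero])
  rcases eq_or_ne (modularJ τ) 1728 with h1728 | h1728
  · exact multipliers_eq_of_modularJ_eq (by rw [h, h1728, map_ofNat])
  have h0' : modularJ τ' ≠ 0 := by rwa [h, map_ne_zero]
  have h1728' : modularJ τ' ≠ 1728 := by
    rwa [h, ← map_ofNat σ, σ.injective.ne_iff]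
  obtain ⟨d, hd, h4, hτ⟩ := exists_multipliers_eq_quadOrder hx him
  have hN := normSet_eq_of_modularJ_eq_map σ h
  obtain ⟨m, hm, -⟩ := exists_mem_normSet_quadOrder_not_isSquare hd h4
  rw [← hτ, ← hN] at hm
  obtain ⟨x', hx', him'⟩ := exists_im_ne_zero_of_mem_normSet hm
  obtain ⟨d', hd', h4', hτ'⟩ := exists_multipliers_eq_quadOrder hx' him'
  have hdd' : d' = d := eq_of_normSet_quadOrder_eq
    (four_lt_of_multipliers_eq hd' h4' hτ' h0' h1728')
    (four_lt_of_multipliers_eq hd h4 hτ h0 h1728) h4' h4 (by rw [← hτ, ← hτ', hN])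
  rw [hτ', hτ, hdd']

/-! ### Lattices of ideals -/

section IdealLattice

variable {K : Type*} [Field K] {R : Subring K} [IsFractionRing R K] (φ : K →+* ℂ)

lemma exists_map_eq_of_forall_mul_mem {I I' : FractionalIdeal R⁰ K} (hI : I ≠ 0) {x : ℂ}
    (h : ∀ v ∈ idealLattice φ I, x * v ∈ idealLattice φ I') :
    ∃ y, φ y = x ∧ FractionalIdeal.spanSingleton R⁰ y * I ≤ I' := by
  obtain ⟨i, hi, hi0⟩ : ∃ i ∈ I, i ≠ 0 := by
    by_contra! h0
    exact hI (FractionalIdeal.eq_zero_iff.2 h0)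
  obtain ⟨k, -, hk⟩ := (mem_idealLattice φ I' _).1 (h (φ i) ⟨i, hi, rfl⟩)
  have hxk : φ (k / i) = x := by
    rw [map_div₀, hk, mul_div_cancel_right₀ _ ((map_ne_zero φ).2 hi0)]
  refine ⟨k / i, hxk, FractionalIdeal.spanSingleton_mul_le_iff.2 fun z hz => ?_⟩
  obtain ⟨w, hw, hwz⟩ := (mem_idealLattice φ I' _).1 (h (φ z) ⟨z, hz, rfl⟩)
  rw [← hxk, ← map_mul] at hwz
  rwa [← φ.injective hwz]

lemma multipliers_idealLattice (I : (FractionalIdeal R⁰ K)ˣ) :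
    multipliers (idealLattice φ (I : FractionalIdeal R⁰ K)) = φ '' (R : Set K) := by
  ext x
  constructor
  · intro hx
    obtain ⟨y, rfl, hy⟩ := exists_map_eq_of_forall_mul_mem φ I.ne_zero hx
    have hy1 := mul_le_mul_left hy ((I⁻¹ : (FractionalIdeal R⁰ K)ˣ) : FractionalIdeal R⁰ K)
    rw [mul_assoc, Units.mul_inv, mul_one, FractionalIdeal.spanSingleton_le_iff_mem,
      FractionalIdeal.mem_one_iff] at hy1
    obtain ⟨r, rfl⟩ := hy1
    exact ⟨r, r.2, rfl⟩
  · rintro ⟨r, hr, rfl⟩ _ ⟨i, hi, rfl⟩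
    exact ⟨r * i, Submodule.smul_mem ((I : FractionalIdeal R⁰ K) : Submodule R K) ⟨r, hr⟩ hi,
      map_mul φ _ _⟩

lemma exists_eq_spanSingleton_mul_of_isHomothetic {I I' : FractionalIdeal R⁰ K} (hI : I ≠ 0)
    (h : IsHomothetic (idealLattice φ I) (idealLattice φ I')) :
    ∃ y, y ≠ 0 ∧ I' = FractionalIdeal.spanSingleton R⁰ y * I := by
  obtain ⟨x, hx, h⟩ := h
  obtain ⟨y, rfl, hy⟩ := exists_map_eq_of_forall_mul_mem φ hI fun v hv => (h _).2 ⟨v, hv, rfl⟩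
  refine ⟨y, (map_ne_zero φ).1 hx, hy.antisymm' ?_⟩
  refine FractionalIdeal.le_spanSingleton_mul_iff.2 fun w hw => ?_
  obtain ⟨_, ⟨b, hb, rfl⟩, hwb⟩ := (h (φ w)).1 ⟨w, hw, rfl⟩
  exact ⟨b, hb, φ.injective ((map_mul φ y b).trans hwb.symm)⟩

lemma classGroup_mk_eq_of_isHomothetic {I I' : (FractionalIdeal R⁰ K)ˣ}
    (h : IsHomothetic (idealLattice φ (I : FractionalIdeal R⁰ K))
      (idealLattice φ (I' : FractionalIdeal R⁰ K))) :
    ClassGroup.mk K I = ClassGroup.mk K I' := by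
  obtain ⟨y, hy, hI'⟩ := exists_eq_spanSingleton_mul_of_isHomothetic φ I.ne_zero h
  have hprod : toPrincipalIdeal R K (Units.mk0 y hy) * I = I' := by
    ext1
    rw [Units.val_mul, coe_toPrincipalIdeal, Units.val_mk0, hI']
  rw [← hprod, map_mul, right_eq_mul, ClassGroup.mk_eq_one_iff, coe_toPrincipalIdeal,
    FractionalIdeal.coe_spanSingleton]
  exact ⟨⟨_, rfl⟩⟩

end IdealLattice

section TotallyComplex

lemma exists_isHomothetic_span_pair {a b : ℂ} (h : (a / b).im ≠ 0) :
    ∃ τ : ℍ, IsHomothetic (upperLattice τ) (Submodule.span ℤ {a, b}) := by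
  wlog hpos : 0 < (a / b).im generalizing a b
  · have hba : 0 < (b / a).im := by
      rw [← inv_div, Complex.inv_im]
      refine div_pos (neg_pos.2 (lt_of_le_of_ne (not_lt.1 hpos) h)) (Complex.normSq_pos.2 ?_)
      rintro h0
      rw [h0, Complex.zero_im] at h
      exact h rfl
    rw [Set.pair_comm]
    exact this hba.ne' hba
  have hb : b ≠ 0 := by
    rintro rfl
    simp at h
  refine ⟨⟨a / b, hpos⟩, b, hb, fun w => ?_⟩
  simp only [Submodule.mem_span_pair, zsmul_eq_mul, mem_upperLattice]
  constructor
  · rintro ⟨m, n, rfl⟩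
    exact ⟨_, ⟨m, n, rfl⟩, by field_simp⟩
  · rintro ⟨_, ⟨m, n, rfl⟩, rfl⟩
    exact ⟨m, n, by field_simp⟩

variable {K : Type*} [Field K]

lemma exists_map_im_ne_zero [NumberField.IsTotallyComplex K] (φ : K →+* ℂ) :
    ∃ x, (φ x).im ≠ 0 := by
  by_contra! h
  refine NumberField.IsTotallyComplex.complexEmbedding_not_isReal φ ?_
  rw [NumberField.ComplexEmbedding.isReal_iff]
  exact RingHom.ext fun x => Complex.conj_eq_iff_im.2 (h x)

variable [CharZero K]

lemma map_im_eq_zero_of_mem_span (φ : K →+* ℂ) {s : Set K} (h : ∀ x ∈ s, (φ x).im = 0) {x : K}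
    (hx : x ∈ Submodule.span ℚ s) : (φ x).im = 0 := by
  induction hx using Submodule.span_induction with
  | mem x hx => exact h x hx
  | zero => rw [map_zero, Complex.zero_im]
  | add x y _ _ hx hy => rw [map_add, Complex.add_im, hx, hy, add_zero]
  | smul q x _ hx =>
    rw [Rat.smul_def, map_mul, map_ratCast, Complex.mul_im, hx, Complex.ratCast_im, mul_zero,
      zero_mul, add_zero]

lemma exists_mem_im_ne_zero [NumberField.IsTotallyComplex K] (φ : K →+* ℂ) {s : Set K}
    (hs : Submodule.span ℚ s = ⊤) : ∃ x ∈ s, (φ x).im ≠ 0 := by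
  by_contra! h
  obtain ⟨x, hx⟩ := exists_map_im_ne_zero φ
  exact hx (map_im_eq_zero_of_mem_span φ h (hs ▸ Submodule.mem_top))

lemma im_div_ne_zero_of_span_eq_top [NumberField.IsTotallyComplex K] (φ : K →+* ℂ) {α β : K}
    (hβ : β ≠ 0) (h : Submodule.span ℚ {α, β} = ⊤) : (φ α / φ β).im ≠ 0 := by
  intro him
  obtain ⟨x, hx⟩ := exists_map_im_ne_zero φ
  obtain ⟨p, q, hpq⟩ := Submodule.mem_span_pair.1 (h ▸ Submodule.mem_top (x := β * x))
  have hφβ : φ β ≠ 0 := (map_ne_zero φ).2 hβ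
  have hφx : φ x = p * (φ α / φ β) + q := by
    have hφ := congrArg φ hpq
    simp only [Rat.smul_def, map_add, map_mul, map_ratCast] at hφ
    field_simp
    linear_combination -hφ
  refine hx ?_
  simp [hφx, him]

end TotallyComplex

lemma exists_eq_span_pair {V : Type*} [AddCommGroup V] [Module ℚ V]
    (hV : Module.finrank ℚ V = 2) (N : Submodule ℤ V) [Submodule.IsLattice ℚ N] :
    ∃ α β : V, β ≠ 0 ∧ N = Submodule.span ℤ {α, β} ∧ Submodule.span ℚ {α, β} = ⊤ := by
  have : Module.Free ℤ N := Submodule.IsLattice.free ℚ N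
  have hN : Module.finrank ℤ N = 2 := by
    rw [Module.finrank, Submodule.IsLattice.rank' ℚ N]
    exact hV
  let b := Module.finBasisOfFinrankEq ℤ N hN
  have hpair : Set.range (fun i => (b i : V)) = {(b 0 : V), (b 1 : V)} := by
    ext v
    simp [Fin.exists_fin_two, eq_comm]
  have hbN : N = Submodule.span ℤ {(b 0 : V), (b 1 : V)} := by
    have h := congrArg (Submodule.map N.subtype) b.span_eq
    rw [Submodule.map_span, ← Set.range_comp, Submodule.map_top, Submodule.range_subtype] at h
    exact h.symm.trans (congrArg _ hpair)
  refine ⟨b 0, b 1, ?_, hbN, ?_⟩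
  · exact fun h => b.ne_zero 1 (Subtype.ext h)
  · rw [← hpair, ← (b.extendOfIsLattice ℚ).span_eq]
    exact congrArg (fun f : Fin 2 → V => Submodule.span ℚ (Set.range f))
      (funext fun i => (b.extendOfIsLattice_apply ℚ i).symm)

lemma exists_classGroup_mk_eq {S K : Type*} [CommRing S] [IsDomain S] [Field K] [Algebra S K]
    [IsFractionRing S K] (c : ClassGroup S) :
    ∃ I : (FractionalIdeal S⁰ K)ˣ, ClassGroup.mk K I = c :=
  ClassGroup.induction K (fun I => ⟨I, rfl⟩) c

section NumberField

variable {K : Type*} [Field K] [NumberField K] {R : Subring K} [IsNumberFieldOrder R]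

lemma span_rat_eq_top {I : FractionalIdeal R⁰ K} (hI : I ≠ 0) :
    Submodule.span ℚ (I : Set K) = ⊤ := by
  obtain ⟨i, hi, hi0⟩ : ∃ i ∈ I, i ≠ 0 := by
    by_contra! h
    exact hI (FractionalIdeal.eq_zero_iff.2 h)
  rw [eq_top_iff]
  intro x _
  have hx : i⁻¹ * x ∈ Submodule.span ℚ (R : Set K) :=
    IsNumberFieldOrder.span_eq_top (R := R) ▸ Submodule.mem_top
  have hmap := Submodule.mem_map_of_mem (f := LinearMap.mulLeft ℚ i) hx
  rw [LinearMap.mulLeft_apply, mul_inv_cancel_left₀ hi0, Submodule.map_span] at hmap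
  refine Submodule.span_mono ?_ hmap
  rintro _ ⟨r, hr, rfl⟩
  rw [LinearMap.mulLeft_apply, mul_comm]
  exact Submodule.smul_mem (I : Submodule R K) ⟨r, hr⟩ hi

lemma isLattice_fractionalIdeal (I : (FractionalIdeal R⁰ K)ˣ) :
    Submodule.IsLattice ℚ (((I : FractionalIdeal R⁰ K) : Submodule R K).restrictScalars ℤ) where
  fg := by
    have : Module.Finite ℤ R := IsNumberFieldOrder.finite
    exact (FractionalIdeal.fg_unit I).restrictScalars
  span_eq_top := span_rat_eq_top I.ne_zero

lemma exists_isHomothetic_idealLattice [NumberField.IsTotallyComplex K]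
    (hK : Module.finrank ℚ K = 2) (φ : K →+* ℂ) (I : (FractionalIdeal R⁰ K)ˣ) :
    ∃ τ : ℍ, IsHomothetic (upperLattice τ) (idealLattice φ (I : FractionalIdeal R⁰ K)) := by
  have := isLattice_fractionalIdeal I
  obtain ⟨α, β, hβ, hI, hspan⟩ := exists_eq_span_pair hK
    (((I : FractionalIdeal R⁰ K) : Submodule R K).restrictScalars ℤ)
  obtain ⟨τ, hτ⟩ := exists_isHomothetic_span_pair (im_div_ne_zero_of_span_eq_top φ hβ hspan)
  refine ⟨τ, ?_⟩
  rw [idealLattice, hI, Submodule.map_span, Set.image_pair]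
  exact hτ

lemma exists_multipliers_eq_and_modularJ_eq [NumberField.IsTotallyComplex K]
    (hK : Module.finrank ℚ K = 2) (φ : K →+* ℂ) (c : ClassGroup R) :
    ∃ τ : ℍ, multipliers (upperLattice τ) = φ '' (R : Set K) ∧
      modularJ τ = classInvariant φ c := by
  obtain ⟨I, rfl⟩ := exists_classGroup_mk_eq (K := K) c
  obtain ⟨τ, hτ⟩ := exists_isHomothetic_idealLattice hK φ I
  exact ⟨τ, by rw [← hτ.multipliers_eq, multipliers_idealLattice],
    by rw [classInvariant_mk, hτ.latticeJ_eq]; rfl⟩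

lemma classInvariant_injective [NumberField.IsTotallyComplex K]
    (hK : Module.finrank ℚ K = 2) (φ : K →+* ℂ) :
    Function.Injective (classInvariant (R := R) φ) := by
  intro c c' h
  obtain ⟨I, rfl⟩ := exists_classGroup_mk_eq (K := K) c
  obtain ⟨I', rfl⟩ := exists_classGroup_mk_eq (K := K) c'
  obtain ⟨τ, hτ⟩ := exists_isHomothetic_idealLattice hK φ I
  obtain ⟨τ', hτ'⟩ := exists_isHomothetic_idealLattice hK φ I'
  rw [classInvariant_mk, classInvariant_mk, hτ.latticeJ_eq, hτ'.latticeJ_eq] at h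
  exact classGroup_mk_eq_of_isHomothetic φ
    ((hτ.symm.trans (isHomothetic_of_modularJ_eq h)).trans hτ')

end NumberField

/-! ### Lattices with given multipliers -/

lemma span_add_one_mul_span_add_span {S P : Type*} [CommRing S] [CommRing P] [Algebra S P]
    (M : Submonoid S) [IsLocalization M P] {a b c p q r t : S} {θ : P}
    (hθ : algebraMap S P a * θ ^ 2 + algebraMap S P b * θ + algebraMap S P c = 0)
    (ht : algebraMap S P t = algebraMap S P a * θ) (h : p * a + q * b + r * c = 1) :
    (FractionalIdeal.spanSingleton M θ + 1) *
      (FractionalIdeal.spanSingleton M (algebraMap S P (-b - t)) +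
        FractionalIdeal.spanSingleton M (algebraMap S P a)) = 1 := by
  have hc : θ * algebraMap S P (-b - t) = algebraMap S P c := by
    rw [map_sub, map_neg, ht]
    linear_combination -hθ
  have htop : Ideal.span {c} ⊔ Ideal.span {t} ⊔ (Ideal.span {-b - t} ⊔ Ideal.span {a}) = ⊤ := by
    have hmem (u x : S) : u * x ∈ Ideal.span {x} :=
      Ideal.mul_mem_left _ u (Ideal.mem_span_singleton_self x)
    have hsum : 1 = r * c + -q * t + (-q * (-b - t) + p * a) := by linear_combination -h
    rw [Ideal.eq_top_iff_one, hsum]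
    exact Submodule.add_mem_sup (Submodule.add_mem_sup (hmem r c) (hmem (-q) t))
      (Submodule.add_mem_sup (hmem (-q) _) (hmem p a))
  rw [add_mul, mul_add, one_mul, FractionalIdeal.spanSingleton_mul_spanSingleton,
    FractionalIdeal.spanSingleton_mul_spanSingleton, hc, mul_comm θ, ← ht]
  simp only [← FractionalIdeal.coeIdeal_span_singleton, ← FractionalIdeal.coeIdeal_sup]
  rw [htop, FractionalIdeal.coeIdeal_top]

lemma idealLattice_spanSingleton_add_one {K : Type*} [Field K] {R : Subring K} [IsFractionRing R K]
    {φ : K →+* ℂ} {θ : K} {τ : ℍ} (hθ : φ θ = τ)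
    (h : ∀ r ∈ R, φ r ∈ multipliers (upperLattice τ)) :
    idealLattice φ (FractionalIdeal.spanSingleton R⁰ θ + 1) = upperLattice τ := by
  ext w
  simp only [mem_idealLattice, FractionalIdeal.mem_add, FractionalIdeal.mem_spanSingleton,
    FractionalIdeal.mem_one_iff]
  constructor
  · rintro ⟨_, ⟨_, ⟨r, rfl⟩, _, ⟨s, rfl⟩, rfl⟩, rfl⟩
    have hr := h r r.2 τ (mem_upperLattice.2 ⟨1, 0, by simp⟩)
    have hs := h s s.2 1 (mem_upperLattice.2 ⟨0, 1, by simp⟩)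
    rw [mul_one] at hs
    rw [map_add, Subring.smul_def, smul_eq_mul, map_mul, hθ]
    exact Submodule.add_mem _ hr hs
  · intro hw
    obtain ⟨m, n, rfl⟩ := mem_upperLattice.1 hw
    exact ⟨m * θ + n, ⟨m * θ, ⟨(m : R), by simp [Subring.smul_def]⟩, n, ⟨(n : R), by simp⟩, rfl⟩,
      by simp [hθ]⟩

section Order

variable {K : Type*} [Field K] [NumberField K] [NumberField.IsTotallyComplex K] {R : Subring K}
  [IsNumberFieldOrder R] (φ : K →+* ℂ)

lemma exists_mem_multipliers_im_ne_zero {τ : ℍ}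
    (h : multipliers (upperLattice τ) = φ '' (R : Set K)) :
    ∃ x ∈ multipliers (upperLattice τ), x.im ≠ 0 := by
  obtain ⟨r, hr, him⟩ := exists_mem_im_ne_zero φ (IsNumberFieldOrder.span_eq_top (R := R))
  exact ⟨φ r, h ▸ ⟨r, hr, rfl⟩, him⟩

lemma exists_classInvariant_eq {τ : ℍ} (h : multipliers (upperLattice τ) = φ '' (R : Set K)) :
    ∃ c : ClassGroup R, classInvariant φ c = modularJ τ := by
  obtain ⟨x, hx, him⟩ := exists_mem_multipliers_im_ne_zero φ h
  obtain ⟨A, B, C, hf⟩ := exists_isPrimitiveForm hx him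
  obtain ⟨t, ht, htτ⟩ : (A * τ : ℂ) ∈ φ '' (R : Set K) :=
    h ▸ hf.mem_multipliers_iff.2 ⟨0, 1, by simp⟩
  have hA : (A : K) ≠ 0 := by exact_mod_cast hf.pos.ne'
  have hθ : φ (t / A) = τ := by
    rw [map_div₀, htτ, map_intCast, mul_div_cancel_left₀]
    exact_mod_cast hf.pos.ne'
  have hroot : (A : K) * (t / A) ^ 2 + B * (t / A) + C = 0 := by
    refine φ.injective ?_
    simp only [map_add, map_mul, map_pow, map_intCast, map_zero, hθ]
    exact hf.eq_zero
  obtain ⟨p, q, r, hpqr⟩ := hf.primitive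
  have hunit := span_add_one_mul_span_add_span (S := R) (P := K) R⁰ (a := A) (b := B) (c := C)
    (p := p) (q := q) (r := r) (t := ⟨t, ht⟩) (θ := t / A) (by simpa using hroot)
    ((mul_div_cancel₀ t hA).symm.trans (by simp)) (by exact_mod_cast hpqr)
  refine ⟨ClassGroup.mk K (Units.mkOfMulEqOne _ _ hunit), ?_⟩
  rw [classInvariant_mk, Units.val_mkOfMulEqOne, idealLattice_spanSingleton_add_one hθ fun r hr =>
    h ▸ ⟨r, hr, rfl⟩]
  rfl

lemma exists_classInvariant_eq_map (hK : Module.finrank ℚ K = 2) (σ : ℂ →+* ℂ)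
    (c : ClassGroup R) : ∃ c' : ClassGroup R, classInvariant φ c' = σ (classInvariant φ c) := by
  obtain ⟨τ, hτ, hj⟩ := exists_multipliers_eq_and_modularJ_eq hK φ c
  obtain ⟨x, hx, him⟩ := exists_mem_multipliers_im_ne_zero φ hτ
  obtain ⟨τ', hτ'⟩ := exists_modularJ_eq (σ (modularJ τ))
  obtain ⟨c', hc'⟩ := exists_classInvariant_eq (R := R) φ
    ((multipliers_eq_of_modularJ_eq_map σ hx him hτ').trans hτ)
  exact ⟨c', by rw [hc', hτ', hj]⟩

variable (R) in
lemma exists_mem_normSet_image_not_isSquare (hK : Module.finrank ℚ K = 2) :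
    ∃ m ∈ normSet (φ '' (R : Set K)), m ≠ 0 ∧ ¬ IsSquare m := by
  obtain ⟨τ, hτ, -⟩ := exists_multipliers_eq_and_modularJ_eq hK φ (1 : ClassGroup R)
  obtain ⟨x, hx, him⟩ := exists_mem_multipliers_im_ne_zero φ hτ
  obtain ⟨d, hd, h4, hτd⟩ := exists_multipliers_eq_quadOrder hx him
  rw [← hτ, hτd]
  exact exists_mem_normSet_quadOrder_not_isSquare hd h4

lemma isRoot_modularPoly_classInvariant (hK : Module.finrank ℚ K = 2) {m : ℕ} [NeZero m]
    (hm : m ∈ normSet (φ '' (R : Set K))) (c : ClassGroup R) :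
    (modularPoly m).IsRoot (classInvariant φ c) := by
  obtain ⟨τ, hτ, hj⟩ := exists_multipliers_eq_and_modularJ_eq hK φ c
  rwa [← hj, isRoot_modularPoly_iff, hτ]

lemma isIntegral_classInvariant (hK : Module.finrank ℚ K = 2) (c : ClassGroup R) :
    IsIntegral ℤ (classInvariant φ c) := by
  obtain ⟨m, hm, hm0, hsq⟩ := exists_mem_normSet_image_not_isSquare R φ hK
  have : NeZero m := ⟨hm0⟩
  exact isIntegral_of_isRoot_modularPoly hsq (isRoot_modularPoly_classInvariant φ hK hm c)

variable (R) in
lemma finite_classGroup (hK : Module.finrank ℚ K = 2) : Finite (ClassGroup R) := by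
  obtain ⟨φ⟩ : Nonempty (K →+* ℂ) := inferInstance
  obtain ⟨m, hm, hm0, hsq⟩ := exists_mem_normSet_image_not_isSquare R φ hK
  have : NeZero m := ⟨hm0⟩
  have hfin := Polynomial.finite_setOfPred_isRoot (modularPoly_ne_zero hsq)
  exact Set.finite_univ_iff.1 (hfin.of_injOn
    (fun c _ => isRoot_modularPoly_classInvariant φ hK hm c)
    (classInvariant_injective hK φ).injOn)

/-! ### The class polynomial -/

variable (R) in
lemma map_classPolynomial (hK : Module.finrank ℚ K = 2) (σ : ℂ →+* ℂ) :
    (classPolynomial R φ).map σ = classPolynomial R φ := by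
  have := finite_classGroup R hK
  have := Fintype.ofFinite (ClassGroup R)
  choose e he using exists_classInvariant_eq_map (R := R) φ hK σ
  have hinj : Function.Injective e := fun c c' h =>
    classInvariant_injective hK φ (σ.injective (by rw [← he, h, he]))
  rw [classPolynomial, finprod_eq_prod_of_fintype, Polynomial.map_prod]
  refine Fintype.prod_bijective e (Finite.injective_iff_bijective.1 hinj) _ _ fun c => ?_
  rw [Polynomial.map_sub, Polynomial.map_X, Polynomial.map_C, he]

variable (R) in
lemma isIntegral_coeff_classPolynomial (hK : Module.finrank ℚ K = 2) (n : ℕ) :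
    IsIntegral ℤ ((classPolynomial R φ).coeff n) := by
  have hlifts : classPolynomial R φ ∈ Polynomial.lifts (algebraMap (integralClosure ℤ ℂ) ℂ) :=
    finprod_induction (· ∈ Polynomial.lifts _) (one_mem _) (fun _ _ => mul_mem) fun c =>
      (Polynomial.mem_lifts _).2
        ⟨Polynomial.X - Polynomial.C ⟨classInvariant φ c, isIntegral_classInvariant φ hK c⟩, by
          rw [Polynomial.map_sub, Polynomial.map_X, Polynomial.map_C]; rfl⟩
  obtain ⟨y, hy⟩ := (Polynomial.lifts_iff_coeff_lifts _).1 hlifts n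
  exact hy ▸ y.2

end Order

section Galois

variable {L : Type*} [Field L] [IsAlgClosed L]

lemma exists_ringHom_extending {F : Type*} [Field F] [Algebra F L] (σ : F ≃+* F) :
    ∃ σ' : L →+* L, ∀ x : F, σ' (algebraMap F L x) = algebraMap F L (σ x) := by
  obtain ⟨ι, v, hv⟩ := exists_isTranscendenceBasis' F L
  have := IsAlgClosed.isAlgClosure_of_transcendence_basis v hv
  let S := Algebra.adjoin F (Set.range v)
  let e := hv.1.aevalEquiv
  let f : S ≃+* S := (e.symm.toRingEquiv.trans (MvPolynomial.mapEquiv ι σ)).trans e.toRingEquiv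
  refine ⟨(IsAlgClosure.equivOfEquiv L L f : L ≃+* L), fun x => ?_⟩
  have hf : f (algebraMap F S x) = algebraMap F S (σ x) := by
    simp only [f, RingEquiv.trans_apply, AlgEquiv.coe_ringEquiv, AlgEquiv.commutes,
      MvPolynomial.algebraMap_eq, MvPolynomial.mapEquiv_apply, MvPolynomial.map_C]
    exact e.commutes (σ x)
  have hext := IsAlgClosure.equivOfEquiv_algebraMap L L f (algebraMap F S x)
  rwa [hf] at hext

lemma exists_int_of_isIntegral_of_fixed [CharZero L] {x : L} (hx : IsIntegral ℤ x)
    (h : ∀ σ : L →+* L, σ x = x) : ∃ n : ℤ, (n : L) = x := by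
  have : IsAlgClosure ℚ (algebraicClosure ℚ L) := algebraicClosure.isAlgClosure ℚ L
  have : IsGalois ℚ (algebraicClosure ℚ L) := IsAlgClosure.isGalois ℚ _
  let y : algebraicClosure ℚ L :=
    ⟨x, mem_algebraicClosure_iff.2 (hx.tower_top (A := ℚ)).isAlgebraic⟩
  have hy : y ∈ Set.range (algebraMap ℚ (algebraicClosure ℚ L)) := by
    rw [InfiniteGalois.mem_range_algebraMap_iff_fixed]
    intro f
    obtain ⟨σ, hσ⟩ := exists_ringHom_extending (L := L) f.toRingEquiv
    exact Subtype.ext ((hσ y).symm.trans (h σ))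
  obtain ⟨q, hq⟩ := hy
  have hqx : algebraMap ℚ L q = x := congrArg Subtype.val hq
  rw [← hqx, isIntegral_algebraMap_iff (algebraMap ℚ L).injective] at hx
  obtain ⟨n, hn⟩ := IsIntegrallyClosed.isIntegral_iff.1 hx
  exact ⟨n, by rw [← hqx, ← hn]; simp⟩

lemma exists_map_intCast_eq [CharZero L] {f : L[X]} (hint : ∀ n, IsIntegral ℤ (f.coeff n))
    (h : ∀ σ : L →+* L, f.map σ = f) : ∃ P : ℤ[X], P.map (Int.castRingHom L) = f := by
  rw [← Polynomial.mem_lifts, Polynomial.lifts_iff_coeff_lifts]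
  intro n
  exact exists_int_of_isIntegral_of_fixed (hint n) fun σ => by rw [← Polynomial.coeff_map, h σ]

end Galois

end

theorem mainTheorem4 {K : Type*} [Field K] [NumberField K] [NumberField.IsTotallyComplex K]
    (hK : Module.finrank ℚ K = 2) (φ : K →+* ℂ) (R : Subring K) [IsNumberFieldOrder R] :
    Finite (ClassGroup R) ∧
      (∀ c : ClassGroup R, IsIntegral ℤ (classInvariant φ c)) ∧
      ∃ P : ℤ[X], P.map (Int.castRingHom ℂ) = classPolynomial R φ :=
  ⟨finite_classGroup R hK, isIntegral_classInvariant φ hK,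
    exists_map_intCast_eq (isIntegral_coeff_classPolynomial R φ hK) (map_classPolynomial R φ hK)⟩
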